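/- For a text $T=t_1\ldots t_n\in\mathbb R^n$ and a pattern $P=p_1\ldots p_m\in\mathbb R^m$ with $1\le m\le n$ and $n\ge 2$, let $S[i]=\big(\sum_{j=1}^m |t_{i+j}-p_j|^2\big)^{1/2}$ for $0\le i\le n-m$ be the text-to-pattern $\ell_2$ distances, and let $0<\varepsilon<1$. The array $S$ can be $(1\pm\varepsilon)$-approximated with high probability in $\mathcal O\big(\frac{n\log^3 n}{\varepsilon^2}\big)$ time, by an algorithm that uses only basic arithmetic operations and no convolution. Precisely: For every $c\in\mathbb N$ there are a program $A$ for the machine described below and constants $C,b$ (all depending on $c$ only) such that for all $n,m,\varepsilon$ as above and all $T\in\mathbb R^n$, $P\in\mathbb R^m$, the program $A$, given $n$, $m$, $\lceil 1/\varepsilon\rceil$, $T$ and $P$, makes at most $C\,\frac{n\log^3 n}{\varepsilon^2}$ steps and writes only words of size at most $(n/\varepsilon)^b$ (that is, of $\mathcal O(\log (n/\varepsilon))$ bits), whatever its random bits are, and with probability at least $1-n^{-c}$ over its random bits it outputs an array $S_\varepsilon$ with $(1-\varepsilon)S[i]\le S_\varepsilon[i]\le(1+\varepsilon)S[i]$ for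 all $0\le i\le n-m$ simultaneously. The machine is a random access machine with fair random bits, at unit cost per operation (operations in expressions and tests and rounds of loops being counted). It has three kinds of memory, each with arrays: *words* (natural numbers with $+$, truncated $-$, $\times$, integer division), which alone serve as indices, loop bounds and in comparisons; *data cells* (real numbers), which hold the input $T,P$ and allow addition, subtraction, and multiplication and division by a word; and *magnitude cells* (real numbers), which hold squares of data cells and allow addition, multiplication and division by a word, and square root, and in which the output is returned. Programs are built from assignments, random bits, sequencing, case distinctions and counting loops. In particular two data cells are never multiplied with each other and magnitudes are never subtracted, so no product of a text letter with a pattern letter, hence no convolution of text and pattern, can be formed. -/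

import Mathlib

open MeasureTheory

/-! A randomized random access machine with three kinds of memory:
* words (natural numbers), used for indices, loop bounds and all control flow;
* data cells (reals), holding the input numbers and whatever is computed from them by additions,
  subtractions and scaling by words; two data cells can never be multiplied with each other;
* magnitude cells (reals), holding squares of data, sums of squares, scalings of those by words,
  and square roots; magnitudes can never be subtracted.
Hence text letters and pattern letters cannot be multiplied with each other, so that neither a
convolution nor any other inner product of text and pattern can be formed; every square that is
taken is the square of a linear form ("sketch") of the input. -/

namespace RAM

/-- Word expressions: constants, registers, entries of word arrays, and the arithmetic of natural
numbers (truncated subtraction, integer division). Arrays are numbered by constants. -/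
inductive WExp where
  | lit (k : ℕ)
  | reg (r : ℕ)
  | arr (a : ℕ) (i : WExp)
  | add (e f : WExp)
  | sub (e f : WExp)
  | mul (e f : WExp)
  | div (e f : WExp)

/-- Data expressions: entries of data arrays, sums, differences, and scaling by a word. -/
inductive DExp where
  | arr (a : ℕ) (i : WExp)
  | add (x y : DExp)
  | sub (x y : DExp)
  | mulWord (x : DExp) (e : WExp)
  | divWord (x : DExp) (e : WExp)

/-- Magnitude expressions: entries of magnitude arrays, squares of data, sums, scaling by a word,
square roots. -/
inductive MExp where
  | arr (a : ℕ) (i : WExp)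
  | sq (x : DExp)
  | add (u v : MExp)
  | mulWord (u : MExp) (e : WExp)
  | divWord (u : MExp) (e : WExp)
  | sqrt (u : MExp)

/-- Programs. Branching is by comparison of words; `loop r e c` runs `c` for the values
`0, 1, …, e - 1` of the register `r`, the bound `e` being evaluated once, at the start. -/
inductive Prog where
  | skip
  | setReg (r : ℕ) (e : WExp)
  | setWord (a : ℕ) (i e : WExp)
  | setData (a : ℕ) (i : WExp) (x : DExp)
  | setMag (a : ℕ) (i : WExp) (u : MExp)
  | flip (r : ℕ)
  | seq (c d : Prog)
  | ifLT (e f : WExp) (c d : Prog)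
  | loop (r : ℕ) (e : WExp) (c : Prog)

/-- Machine states. `coins` is the number of random bits used so far, `time` the number of steps
made so far, `peak` the largest word written so far. -/
structure State where
  reg : ℕ → ℕ
  word : ℕ → ℕ → ℕ
  data : ℕ → ℕ → ℝ
  mag : ℕ → ℕ → ℝ
  coins : ℕ
  time : ℕ
  peak : ℕ

/-- The number of operations in an expression (each access to memory or a constant is one). -/
def WExp.size : WExp → ℕ
  | lit _ => 1
  | reg _ => 1
  | arr _ i => i.size + 1
  | add e f => e.size + f.size + 1
  | sub e f => e.size + f.size + 1
  | mul e f => e.size + f.size + 1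
  | div e f => e.size + f.size + 1

def DExp.size : DExp → ℕ
  | arr _ i => i.size + 1
  | add x y => x.size + y.size + 1
  | sub x y => x.size + y.size + 1
  | mulWord x e => x.size + e.size + 1
  | divWord x e => x.size + e.size + 1

def MExp.size : MExp → ℕ
  | arr _ i => i.size + 1
  | sq x => x.size + 1
  | add u v => u.size + v.size + 1
  | mulWord u e => u.size + e.size + 1
  | divWord u e => u.size + e.size + 1
  | sqrt u => u.size + 1

def WExp.eval (s : State) : WExp → ℕ
  | lit k => k
  | reg r => s.reg r
  | arr a i => s.word a (i.eval s)
  | add e f => e.eval s + f.eval s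
  | sub e f => e.eval s - f.eval s
  | mul e f => e.eval s * f.eval s
  | div e f => e.eval s / f.eval s

noncomputable def DExp.eval (s : State) : DExp → ℝ
  | arr a i => s.data a (i.eval s)
  | add x y => x.eval s + y.eval s
  | sub x y => x.eval s - y.eval s
  | mulWord x e => x.eval s * (e.eval s : ℝ)
  | divWord x e => x.eval s / (e.eval s : ℝ)

noncomputable def MExp.eval (s : State) : MExp → ℝ
  | arr a i => s.mag a (i.eval s)
  | sq x => (x.eval s) ^ 2
  | add u v => u.eval s + v.eval s
  | mulWord u e => u.eval s * (e.eval s : ℝ)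
  | divWord u e => u.eval s / (e.eval s : ℝ)
  | sqrt u => Real.sqrt (u.eval s)

/-- Let `t` steps pass. -/
def State.tick (t : ℕ) (s : State) : State := { s with time := s.time + t }

/-- Write the word `v` to the register `r`. -/
def State.writeReg (r v : ℕ) (s : State) : State :=
  { s with reg := Function.update s.reg r v, peak := max s.peak v }

/-- Write the word `v` to the entry `i` of the word array `a`. -/
def State.writeWord (a i v : ℕ) (s : State) : State :=
  { s with word := Function.update s.word a (Function.update (s.word a) i v),
           peak := max s.peak v }

/-- Write `v` to the entry `i` of the data array `a`. -/
noncomputable def State.writeData (a i : ℕ) (v : ℝ) (s : State) : State :=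
  { s with data := Function.update s.data a (Function.update (s.data a) i v) }

/-- Write `v` to the entry `i` of the magnitude array `a`. -/
noncomputable def State.writeMag (a i : ℕ) (v : ℝ) (s : State) : State :=
  { s with mag := Function.update s.mag a (Function.update (s.mag a) i v) }

/-- Write the next random bit to the register `r`. -/
def State.flipCoin (ω : ℕ → Bool) (r : ℕ) (s : State) : State :=
  { s.writeReg r (ω s.coins).toNat with coins := s.coins + 1 }

/-- `iter f N s` applies `f 0`, …, `f (N - 1)` in this order. -/
def iter (f : ℕ → State → State) : ℕ → State → State
  | 0, s => s
  | N + 1, s => f N (iter f N s)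

/-- Run a program on a sequence `ω` of random bits. Every instruction, every test and every round
of a loop takes one step, plus the number of operations in the expressions evaluated for it. -/
noncomputable def Prog.run (ω : ℕ → Bool) : Prog → State → State
  | skip, s => s.tick 1
  | setReg r e, s => (s.writeReg r (e.eval s)).tick (e.size + 1)
  | setWord a i e, s => (s.writeWord a (i.eval s) (e.eval s)).tick (i.size + e.size + 1)
  | setData a i x, s => (s.writeData a (i.eval s) (x.eval s)).tick (i.size + x.size + 1)
  | setMag a i u, s => (s.writeMag a (i.eval s) (u.eval s)).tick (i.size + u.size + 1)
  | flip r, s => (s.flipCoin ω r).tick 1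
  | seq c d, s => d.run ω (c.run ω s)
  | ifLT e f c d, s =>
      if e.eval s < f.eval s then c.run ω (s.tick (e.size + f.size + 1))
      else d.run ω (s.tick (e.size + f.size + 1))
  | loop r e c, s =>
      iter (fun k s' => c.run ω ((s'.writeReg r k).tick 1)) (e.eval s) (s.tick (e.size + 1))

/-- Independent fair random bits. -/
noncomputable def coinMeasure : Measure (ℕ → Bool) :=
  Measure.infinitePi fun _ => (PMF.uniformOfFintype Bool).toMeasure

end RAM

namespace TextPattern

/-- `S[i] = ‖T[i+1 .. i+m] - P‖₂`, the `ℓ₂` distance of the pattern and the text at location `i`. -/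
noncomputable def dist₂ {n m : ℕ} (T : Fin n → ℝ) (P : Fin m → ℝ) (i : ℕ) (hi : i + m ≤ n) : ℝ :=
  Real.sqrt (∑ j : Fin m, |T ⟨i + j, by omega⟩ - P j| ^ 2)

/-- The initial state: the registers `0, 1, 2` hold `n`, `m` and the precision `q`, the data arrays
`0` and `1` hold the text and the pattern; everything else is `0`. -/
noncomputable def input {n m : ℕ} (q : ℕ) (T : Fin n → ℝ) (P : Fin m → ℝ) : RAM.State where
  reg r := if r = 0 then n else if r = 1 then m else if r = 2 then q else 0
  word _ _ := 0
  data a j :=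
    if a = 0 then (if h : j < n then T ⟨j, h⟩ else 0)
    else if a = 1 then (if h : j < m then P ⟨j, h⟩ else 0)
    else 0
  mag _ _ := 0
  coins := 0
  time := 0
  peak := 0

/-- The final state of the program `A` on the text `T`, the pattern `P` and the error parameter `ε`,
which the program is given in the form `⌈1 / ε⌉`. The output is the magnitude array `0`. -/
noncomputable def final {n m : ℕ} (A : RAM.Prog) (ε : ℝ) (T : Fin n → ℝ) (P : Fin m → ℝ)
    (ω : ℕ → Bool) : RAM.State :=
  A.run ω (input ⌈1 / ε⌉₊ T P)

/-- The array `S` is a `(1 ± ε)`-approximation of the text-to-pattern `ℓ₂` distances. -/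
def IsApprox {n m : ℕ} (ε : ℝ) (T : Fin n → ℝ) (P : Fin m → ℝ) (S : ℕ → ℝ) : Prop :=
  ∀ (i : ℕ) (hi : i + m ≤ n),
    (1 - ε) * dist₂ T P i hi ≤ S i ∧ S i ≤ (1 + ε) * dist₂ T P i hi

end TextPattern

/-! The program is an oblivious sketching algorithm. With `L = ⌈log₂ n⌉`, let `D` be the least power
of two that is at least `κ * L * ⌈1 / ε⌉`, where `κ` depends only on `c`, and let `d = D ^ 2`.
The text is cut into blocks of length `d` at the multiples of `d`, and the pattern is cut into
blocks in all `d` alignments relative to these. The squared distance at a window is then the sum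
over its full blocks of `‖t - p‖ ^ 2`, for the blocks `t` of the text and `p` of the pattern in the
alignment of the window, and of the squared differences of at most `2 * d` outer letters, which are
computed exactly.

*Sketches.* Neighbouring vectors are merged in a binary tree: at level `t`, a vector at `p` absorbs
the vector at `p + 2 ^ t`, rotated by `diag α · H · diag β / D` for a Hadamard matrix `H` and random
signs `α`, `β` that are fresh for each level but the same for all positions (`mix`, `sketch`). Hence
text and pattern are merged independently and the difference of their sketches is the sketch of
their difference (`sketch_sub`). A rotation preserves norms, so a level changes the total energy of
the vectors it merges by an inner product that is a decoupled Rademacher chaos in `α`, `β`. As the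
entries of `H / D` are `± 1 / D`, its standard deviation is at most `1 / D` times the energy, and
its exponential moment at this scale is bounded (`avg_exp_abs_bilinear`, `avg_exp_energy_change`).
The moments of the levels multiply (`avg_exp_distortion`), and Markov's inequality shows that the
sketch of `2 ^ k` vectors preserves their energy up to a factor `1 ± ε`, except with probability
`4 ^ k * exp (- D * ε / 4)` (`coinMeasure_nsq_sketch`). Since `D * ε ≥ κ * L`, this survives a union
bound over all windows and levels; repetitions and medians are not needed.

*Windows.* The blocks of a window are split into at most one piece of length `2 ^ k` for each `k`,
according to the binary digits of their number `M = m / d - 1`, which is the same for all windows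
(`sum_range_eq_sum_pieces`). At level `k` the text array holds the sketches of all runs of `2 ^ k`
blocks, and the pattern array those that are needed of each alignment, so that a piece costs
`O(d)` steps per window. The levels of the text cost `O(n * log d)` each by the fast Hadamard
transform. Therefore the total is `O(n * d * log n) = O(n * (log n) ^ 3 / ε ^ 2)` steps
(`runs_program`, `time_bound`). If
`d` is so large that `M = 0`, only the outer letters are used.

The run of the program is followed by means of Hoare triples with time bounds, `RAM.Runs`, together
with the fact that a program changes only the memory that it writes to, `RAM.Frame`. -/

namespace Sketch

/-! ### Averages over random signs -/

/-- The average of `f` over all vectors of `N` bits. -/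
noncomputable def avg (N : ℕ) (f : (Fin N → Bool) → ℝ) : ℝ := (∑ s, f s) / 2 ^ N

/-- The sign encoded by a bit. -/
def sgn (b : Bool) : ℝ := 1 - 2 * (b.toNat : ℝ)

@[simp] lemma sgn_true : sgn true = -1 := by norm_num [sgn]

@[simp] lemma sgn_false : sgn false = 1 := by norm_num [sgn]

lemma sgn_sq (b : Bool) : sgn b ^ 2 = 1 := by cases b <;> norm_num

lemma avg_mono {N : ℕ} {f g : (Fin N → Bool) → ℝ} (h : ∀ s, f s ≤ g s) : avg N f ≤ avg N g := by
  unfold avg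
  gcongr with s
  exact h s

lemma avg_const (N : ℕ) (c : ℝ) : avg N (fun _ => c) = c := by
  simp [avg]

lemma avg_add_fun {N : ℕ} (f g : (Fin N → Bool) → ℝ) :
    avg N (fun s => f s + g s) = avg N f + avg N g := by
  simp only [avg, Finset.sum_add_distrib, add_div]

lemma avg_const_mul {N : ℕ} (c : ℝ) (f : (Fin N → Bool) → ℝ) :
    avg N (fun s => c * f s) = c * avg N f := by
  simp only [avg, ← Finset.mul_sum, mul_div_assoc]

lemma avg_finset_sum {N : ℕ} {ι : Type*} (S : Finset ι) (f : ι → (Fin N → Bool) → ℝ) :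
    avg N (fun s => ∑ i ∈ S, f i s) = ∑ i ∈ S, avg N (f i) := by
  simp only [avg, Finset.sum_div]
  rw [Finset.sum_comm]

lemma avg_append (N M : ℕ) (f : (Fin (N + M) → Bool) → ℝ) :
    avg (N + M) f = avg N (fun s => avg M (fun s' => f (Fin.append s s'))) := by
  simp only [avg]
  rw [← (Fin.appendEquiv N M).sum_comp, Fintype.sum_prod_type, Finset.sum_div, Finset.sum_div]
  refine Finset.sum_congr rfl fun s _ => ?_
  rw [pow_add, div_div, mul_comm (2 ^ N : ℝ)]
  rfl

lemma avg_cons (N : ℕ) (f : (Fin (N + 1) → Bool) → ℝ) :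
    avg (N + 1) f =
      (avg N (fun s => f (Fin.cons true s)) + avg N (fun s => f (Fin.cons false s))) / 2 := by
  simp only [avg]
  rw [← (Fin.consEquiv fun _ : Fin (N + 1) => Bool).sum_comp, Fintype.sum_prod_type,
    Fintype.sum_bool, pow_succ, ← add_div, div_div]
  rfl

lemma avg_exp_linear (N : ℕ) (c : Fin N → ℝ) :
    avg N (fun s => Real.exp (∑ a, sgn (s a) * c a)) ≤ Real.exp ((∑ a, c a ^ 2) / 2) := by
  have h : avg N (fun s => Real.exp (∑ a, sgn (s a) * c a)) = ∏ a, Real.cosh (c a) := by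
    have h1 : ∀ a, Real.cosh (c a) = (∑ b : Bool, Real.exp (sgn b * c a)) / 2 := by
      intro a
      rw [Fintype.sum_bool, sgn_true, sgn_false, Real.cosh_eq, one_mul, neg_one_mul, add_comm]
    simp only [h1, Finset.prod_div_distrib, Finset.prod_univ_sum, Real.exp_sum, avg,
      Fintype.piFinset_univ]
    simp
  rw [h, Finset.sum_div, Real.exp_sum]
  exact Finset.prod_le_prod (fun a _ => (Real.cosh_pos _).le) fun a _ => Real.cosh_le_exp_half_sq _

/-- The square of a Rademacher sum has a bounded exponential moment. The offset `z` and the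
parameter `u`, which decreases by twice the variance of each sign that is averaged out, make the
induction on the number of signs work. -/
lemma avg_exp_sq_aux (N : ℕ) : ∀ (c : Fin N → ℝ) (z u : ℝ), 2 ≤ u - 2 * ∑ a, c a ^ 2 →
    avg N (fun s => Real.exp ((z + ∑ a, sgn (s a) * c a) ^ 2 / u)) ≤
      Real.exp ((∑ a, c a ^ 2) / 2) * Real.exp (z ^ 2 / (u - 2 * ∑ a, c a ^ 2)) := by
  induction N with
  | zero => intro c z u hu; simp [avg]
  | succ N ih =>
    intro c z u hu
    rw [Fin.sum_univ_succ] at hu ⊢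
    set S := ∑ a : Fin N, c a.succ ^ 2
    set x := c 0
    set v := u - 2 * S with hv
    have hx : 0 ≤ x ^ 2 := sq_nonneg x
    have hvx : 2 ≤ v - 2 * x ^ 2 := by rw [hv]; linarith
    have hv2 : 2 ≤ v := by linarith
    have hp : ∀ b : Bool, avg N (fun s => Real.exp ((z + ∑ a : Fin (N + 1),
        sgn ((Fin.cons b s : Fin (N + 1) → Bool) a) * c a) ^ 2 / u)) ≤
        Real.exp (S / 2) * Real.exp ((z + sgn b * x) ^ 2 / v) := by
      intro b
      have := ih (fun a => c a.succ) (z + sgn b * x) u hv2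
      simpa [Fin.sum_univ_succ, add_assoc, x] using this
    rw [avg_cons]
    have h1 := hp true
    have h2 := hp false
    simp only [sgn_true, sgn_false] at h1 h2
    have key : (Real.exp ((z + -1 * x) ^ 2 / v) + Real.exp ((z + 1 * x) ^ 2 / v)) / 2 ≤
        Real.exp (x ^ 2 / 2) * Real.exp (z ^ 2 / (v - 2 * x ^ 2)) := by
      have e : (Real.exp ((z + -1 * x) ^ 2 / v) + Real.exp ((z + 1 * x) ^ 2 / v)) / 2 =
          Real.exp ((z ^ 2 + x ^ 2) / v) * Real.cosh (2 * z * x / v) := by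
        rw [show (z + -1 * x) ^ 2 / v = (z ^ 2 + x ^ 2) / v + -(2 * z * x / v) by ring,
          show (z + 1 * x) ^ 2 / v = (z ^ 2 + x ^ 2) / v + 2 * z * x / v by ring,
          Real.cosh_eq, Real.exp_add, Real.exp_add]
        ring
      rw [e, ← Real.exp_add]
      refine (mul_le_mul_of_nonneg_left (Real.cosh_le_exp_half_sq _) (Real.exp_pos _).le).trans ?_
      rw [← Real.exp_add, Real.exp_le_exp]
      have a1 : x ^ 2 / v ≤ x ^ 2 / 2 := by gcongr
      have a2 : 1 / v + 2 * x ^ 2 / v ^ 2 ≤ 1 / (v - 2 * x ^ 2) := by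
        rw [div_add_div _ _ (by positivity) (by positivity), div_le_div_iff₀ (by positivity)
          (by linarith)]
        nlinarith [mul_nonneg hx hx, mul_nonneg (mul_nonneg hx hx) (by linarith : 0 ≤ v)]
      have a3 := mul_le_mul_of_nonneg_left a2 (sq_nonneg z)
      calc (z ^ 2 + x ^ 2) / v + (2 * z * x / v) ^ 2 / 2
          = x ^ 2 / v + z ^ 2 * (1 / v + 2 * x ^ 2 / v ^ 2) := by ring_nf
        _ ≤ x ^ 2 / 2 + z ^ 2 * (1 / (v - 2 * x ^ 2)) := add_le_add a1 a3
        _ = _ := by ring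
    have e2 : u - 2 * (x ^ 2 + S) = v - 2 * x ^ 2 := by rw [hv]; ring
    rw [e2, add_div (x ^ 2), Real.exp_add]
    have := mul_le_mul_of_nonneg_left key (Real.exp_pos (S / 2)).le
    linarith

lemma avg_exp_sq {N : ℕ} (c : Fin N → ℝ) {κ : ℝ} (hκ : 0 ≤ κ) (h : κ * ∑ a, c a ^ 2 ≤ 1 / 4) :
    avg N (fun s => Real.exp (κ * (∑ a, sgn (s a) * c a) ^ 2)) ≤ Real.exp (1 / 2) := by
  have hs : ∑ a, (2 * Real.sqrt κ * c a) ^ 2 = 4 * (κ * ∑ a, c a ^ 2) := by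
    rw [Finset.mul_sum, Finset.mul_sum]
    refine Finset.sum_congr rfl fun a _ => ?_
    rw [mul_pow, mul_pow, Real.sq_sqrt hκ]
    ring
  have := avg_exp_sq_aux N (fun a => 2 * Real.sqrt κ * c a) 0 4 (by rw [hs]; linarith)
  rw [hs] at this
  have e : ∀ s : Fin N → Bool, (0 + ∑ a, sgn (s a) * (2 * Real.sqrt κ * c a)) ^ 2 / 4 =
      κ * (∑ a, sgn (s a) * c a) ^ 2 := by
    intro s
    have : ∑ a, sgn (s a) * (2 * Real.sqrt κ * c a) =
        2 * Real.sqrt κ * ∑ a, sgn (s a) * c a := by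
      rw [Finset.mul_sum]
      exact Finset.sum_congr rfl fun a _ => by ring
    rw [this, zero_add, mul_pow, mul_pow, Real.sq_sqrt hκ]
    ring
  simp only [e] at this
  refine this.trans ?_
  rw [← Real.exp_add, Real.exp_le_exp]
  simp
  linarith

/-- A decoupled Rademacher chaos of order two has a bounded exponential moment at the scale of its
standard deviation: conditionally on `β` it is a Rademacher sum, and the sum of squares that this
leaves is, by convexity of `exp`, reduced to one square of a Rademacher sum in `β`. -/
lemma avg_exp_bilinear {N : ℕ} (A : Fin N → Fin N → ℝ) {l : ℝ}
    (h : l ^ 2 * ∑ a, ∑ b, A a b ^ 2 ≤ 1 / 2) :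
    avg N (fun β => avg N (fun α => Real.exp (l * ∑ a, ∑ b, sgn (α a) * sgn (β b) * A a b))) ≤
      Real.exp (1 / 2) := by
  set G : Fin N → ℝ := fun a => ∑ b, A a b ^ 2 with hG
  set F := ∑ a, G a with hF
  have hG0 : ∀ a, 0 ≤ G a := fun a => Finset.sum_nonneg fun b _ => sq_nonneg _
  have hF0 : 0 ≤ F := Finset.sum_nonneg fun a _ => hG0 a
  have hz : ∀ a, G a = 0 → ∀ b, A a b = 0 := by
    intro a ha b
    have := (Finset.sum_eq_zero_iff_of_nonneg fun b _ => sq_nonneg (A a b)).1 ha b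
      (Finset.mem_univ _)
    exact pow_eq_zero_iff (two_ne_zero) |>.1 this
  -- averaging over `α` first
  have h1 : ∀ β : Fin N → Bool,
      avg N (fun α => Real.exp (l * ∑ a, ∑ b, sgn (α a) * sgn (β b) * A a b)) ≤
        Real.exp (∑ a, l ^ 2 / 2 * (∑ b, sgn (β b) * A a b) ^ 2) := by
    intro β
    have := avg_exp_linear N (fun a => l * ∑ b, sgn (β b) * A a b)
    have e : ∀ α : Fin N → Bool, l * ∑ a, ∑ b, sgn (α a) * sgn (β b) * A a b =
        ∑ a, sgn (α a) * (l * ∑ b, sgn (β b) * A a b) := by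
      intro α
      rw [Finset.mul_sum]
      refine Finset.sum_congr rfl fun a _ => ?_
      rw [Finset.mul_sum, Finset.mul_sum, Finset.mul_sum]
      exact Finset.sum_congr rfl fun b _ => by ring
    simp only [e]
    refine this.trans (le_of_eq ?_)
    rw [Finset.sum_div]
    congr 1
    exact Finset.sum_congr rfl fun a _ => by ring
  refine (avg_mono h1).trans ?_
  rcases hF0.eq_or_lt with hF1 | hF1
  · have : ∀ a b, A a b = 0 := by
      intro a b
      exact hz a ((Finset.sum_eq_zero_iff_of_nonneg fun a _ => hG0 a).1 (by rw [← hF, ← hF1]) a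
        (Finset.mem_univ _)) b
    simp only [this, mul_zero, Finset.sum_const_zero]
    simp [avg_const]
  · have h2 : ∀ β : Fin N → Bool,
        Real.exp (∑ a, l ^ 2 / 2 * (∑ b, sgn (β b) * A a b) ^ 2) ≤
          ∑ a, G a / F * Real.exp (l ^ 2 / 2 * (F / G a) * (∑ b, sgn (β b) * A a b) ^ 2) := by
      intro β
      have := convexOn_exp.map_sum_le (t := Finset.univ) (w := fun a => G a / F)
        (p := fun a => l ^ 2 / 2 * (F / G a) * (∑ b, sgn (β b) * A a b) ^ 2)
        (fun a _ => div_nonneg (hG0 a) hF0) (by rw [← Finset.sum_div, ← hF, div_self hF1.ne'])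
        (fun a _ => Set.mem_univ _)
      simp only [smul_eq_mul] at this
      refine le_trans (le_of_eq ?_) this
      congr 1
      refine Finset.sum_congr rfl fun a _ => ?_
      rcases eq_or_ne (G a) 0 with h0 | h0
      · simp [hz a h0]
      · field_simp
    refine (avg_mono h2).trans ?_
    rw [avg_finset_sum]
    calc ∑ a, avg N (fun β => G a / F *
            Real.exp (l ^ 2 / 2 * (F / G a) * (∑ b, sgn (β b) * A a b) ^ 2))
        ≤ ∑ a, G a / F * Real.exp (1 / 2) := by
          refine Finset.sum_le_sum fun a _ => ?_
          rw [avg_const_mul]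
          refine mul_le_mul_of_nonneg_left ?_ (div_nonneg (hG0 a) hF0)
          refine avg_exp_sq _ (mul_nonneg (by positivity) (div_nonneg hF0 (hG0 a))) ?_
          change l ^ 2 / 2 * (F / G a) * G a ≤ 1 / 4
          rcases eq_or_ne (G a) 0 with h0 | h0
          · rw [h0]; norm_num
          · rw [mul_assoc, div_mul_cancel₀ _ h0]; linarith
      _ = Real.exp (1 / 2) := by
          rw [← Finset.sum_mul, ← Finset.sum_div, ← hF, div_self hF1.ne', one_mul]

lemma avg_exp_abs_bilinear {N : ℕ} (A : Fin N → Fin N → ℝ) {l : ℝ}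
    (h : l ^ 2 * ∑ a, ∑ b, A a b ^ 2 ≤ 1 / 2) :
    avg N (fun β => avg N (fun α =>
      Real.exp (l * |∑ a, ∑ b, sgn (α a) * sgn (β b) * A a b|))) ≤ 4 := by
  have h1 := avg_exp_bilinear A h
  have h2 := avg_exp_bilinear A (l := -l) (by rwa [neg_sq])
  have h3 : ∀ x : ℝ, Real.exp (l * |x|) ≤ Real.exp (l * x) + Real.exp (-l * x) := by
    intro x
    rcases abs_cases x with ⟨hx, _⟩ | ⟨hx, _⟩ <;> rw [hx]
    · linarith [Real.exp_pos (-l * x)]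
    · rw [mul_neg, neg_mul]; linarith [Real.exp_pos (l * x)]
  have h4 : Real.exp (1 / 2) ≤ 2 := by
    have := Real.exp_one_lt_d9
    have h5 : Real.exp (1 / 2) ^ 2 = Real.exp 1 := by
      rw [← Real.exp_nat_mul]; norm_num
    nlinarith [Real.exp_pos (1 / 2)]
  refine (avg_mono fun β => avg_mono fun α => h3 _).trans ?_
  simp only [avg_add_fun]
  linarith

/-! ### Merging vectors by random rotations -/

/-- The squared `ℓ₂` norm of a vector. -/
def nsq {d : ℕ} (v : Fin d → ℝ) : ℝ := ∑ a, v a ^ 2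

lemma nsq_nonneg {d : ℕ} (v : Fin d → ℝ) : 0 ≤ nsq v := Finset.sum_nonneg fun _ _ => sq_nonneg _

/-- `H` has entries `±1` and pairwise orthogonal columns; for the latter it is the resulting
scaled isometry that is recorded. -/
structure IsHadamard {d : ℕ} (H : Fin d → Fin d → ℝ) : Prop where
  entry : ∀ a b, H a b ^ 2 = 1
  iso : ∀ v : Fin d → ℝ, ∑ a, (∑ b, H a b * v b) ^ 2 = d * nsq v

/-- The random rotation `diag α · H · diag β / D`, where `D = √d`. -/
noncomputable def rot {d : ℕ} (D : ℝ) (H : Fin d → Fin d → ℝ) (β α : Fin d → Bool)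
    (v : Fin d → ℝ) : Fin d → ℝ :=
  fun a => sgn (α a) * (∑ b, H a b * (sgn (β b) * v b)) / D

/-- One level of the sketch: the vector at `p` absorbs the rotated vector at `p + h`. -/
noncomputable def mix {d : ℕ} (D : ℝ) (H : Fin d → Fin d → ℝ) (β α : Fin d → Bool) (h : ℕ)
    (f : ℕ → Fin d → ℝ) : ℕ → Fin d → ℝ :=
  fun p => f p + rot D H β α (f (p + h))

lemma nsq_rot {d : ℕ} {D : ℝ} {H : Fin d → Fin d → ℝ} (hH : IsHadamard H) (hD : D ≠ 0)
    (hd : D ^ 2 = d) (β α : Fin d → Bool) (v : Fin d → ℝ) : nsq (rot D H β α v) = nsq v := by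
  have h1 := hH.iso fun b => sgn (β b) * v b
  have h2 : nsq (fun b => sgn (β b) * v b) = nsq v := by
    simp only [nsq, mul_pow, sgn_sq, one_mul]
  rw [h2] at h1
  simp only [nsq, rot, div_pow, mul_pow, sgn_sq, one_mul]
  rw [← Finset.sum_div, h1, hd, mul_div_cancel_left₀ _ (by rw [← hd]; positivity)]
  rfl

lemma rot_sub {d : ℕ} (D : ℝ) (H : Fin d → Fin d → ℝ) (β α : Fin d → Bool) (v w : Fin d → ℝ) :
    rot D H β α (v - w) = rot D H β α v - rot D H β α w := by
  ext a
  simp only [rot, Pi.sub_apply, mul_sub, Finset.sum_sub_distrib, sub_div]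

lemma rot_zero {d : ℕ} (D : ℝ) (H : Fin d → Fin d → ℝ) (β α : Fin d → Bool) :
    rot D H β α 0 = 0 := by
  ext a
  simp [rot]

lemma sum_range_two_mul {M : Type*} [AddCommMonoid M] (g : ℕ → M) (N : ℕ) :
    ∑ b ∈ Finset.range (2 * N), g b = ∑ b ∈ Finset.range N, (g (2 * b) + g (2 * b + 1)) := by
  induction N with
  | zero => simp
  | succ N ih =>
    rw [Nat.mul_succ, Finset.sum_range_succ, Finset.sum_range_succ, ih, Finset.sum_range_succ,
      add_assoc]

/-- One level of the sketch changes the total energy of the vectors that it merges by a relative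
amount of order `1 / D` only, with exponential tails. The change is a decoupled chaos in the signs
`α`, `β`, and as the entries of `H / D` are `±1 / D`, the Frobenius norm of its matrix is at most
`1 / D` times the geometric mean of the energies of the left and of the right vectors. -/
lemma avg_exp_energy_change {d : ℕ} {D : ℝ} {H : Fin d → Fin d → ℝ} (hH : IsHadamard H)
    (hD : 0 < D) (hd : D ^ 2 = d) (f : ℕ → Fin d → ℝ) (h N : ℕ) :
    avg d (fun β => avg d (fun α => Real.exp (D / 2 *
      (|∑ b ∈ Finset.range N, nsq (mix D H β α h f (b * (2 * h))) -
        ∑ b ∈ Finset.range (2 * N), nsq (f (b * h))| /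
        ∑ b ∈ Finset.range (2 * N), nsq (f (b * h)))))) ≤ 4 := by
  set X := ∑ b ∈ Finset.range (2 * N), nsq (f (b * h)) with hX
  set u : ℕ → Fin d → ℝ := fun b => f (b * (2 * h)) with hu
  set v : ℕ → Fin d → ℝ := fun b => f (b * (2 * h) + h) with hv
  have hXs : X = ∑ b ∈ Finset.range N, nsq (u b) + ∑ b ∈ Finset.range N, nsq (v b) := by
    rw [hX, sum_range_two_mul, ← Finset.sum_add_distrib]
    refine Finset.sum_congr rfl fun b _ => ?_
    rw [hu, hv]
    congr 3 <;> ring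
  set A : Fin d → Fin d → ℝ := fun a b => H a b * ∑ j ∈ Finset.range N, u j a * v j b / D with hA
  have hchg : ∀ β α : Fin d → Bool,
      ∑ b ∈ Finset.range N, nsq (mix D H β α h f (b * (2 * h))) - X =
        2 * ∑ a, ∑ b, sgn (α a) * sgn (β b) * A a b := by
    intro β α
    have e1 : ∀ j, nsq (mix D H β α h f (j * (2 * h))) =
        nsq (u j) + nsq (v j) + 2 * ∑ a, u j a * rot D H β α (v j) a := by
      intro j
      rw [← nsq_rot hH hD.ne' hd β α (v j)]
      simp only [nsq, mix, Pi.add_apply, Finset.mul_sum, ← Finset.sum_add_distrib]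
      refine Finset.sum_congr rfl fun a _ => ?_
      simp only [hu, hv]
      ring
    simp only [e1, Finset.sum_add_distrib, hXs, add_sub_cancel_left]
    rw [← Finset.mul_sum, Finset.sum_comm]
    congr 1
    refine Finset.sum_congr rfl fun a _ => ?_
    simp only [rot, hA, Finset.mul_sum, Finset.sum_div]
    rw [Finset.sum_comm]
    refine Finset.sum_congr rfl fun b _ => Finset.sum_congr rfl fun j _ => ?_
    ring
  have hF : ∑ a, ∑ b, A a b ^ 2 ≤ X ^ 2 / (4 * D ^ 2) := by
    have e2 : ∀ a b, A a b ^ 2 ≤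
        (∑ j ∈ Finset.range N, u j a ^ 2) * (∑ j ∈ Finset.range N, v j b ^ 2) / D ^ 2 := by
      intro a b
      simp only [hA, mul_pow, hH.entry, one_mul, ← Finset.sum_div, div_pow]
      gcongr
      exact Finset.sum_mul_sq_le_sq_mul_sq _ _ _
    calc ∑ a, ∑ b, A a b ^ 2
        ≤ ∑ a, ∑ b, (∑ j ∈ Finset.range N, u j a ^ 2) *
            (∑ j ∈ Finset.range N, v j b ^ 2) / D ^ 2 :=
          Finset.sum_le_sum fun a _ => Finset.sum_le_sum fun b _ => e2 a b
      _ = (∑ b ∈ Finset.range N, nsq (u b)) * (∑ b ∈ Finset.range N, nsq (v b)) / D ^ 2 := by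
          simp only [← Finset.sum_div, nsq]
          rw [Finset.sum_comm (s := Finset.range N), Finset.sum_comm (s := Finset.range N),
            Finset.sum_mul_sum]
      _ ≤ X ^ 2 / (4 * D ^ 2) := by
          rw [div_le_div_iff₀ (by positivity) (by positivity), hXs]
          nlinarith [mul_nonneg (sq_nonneg D) (sq_nonneg
            ((∑ b ∈ Finset.range N, nsq (u b)) - ∑ b ∈ Finset.range N, nsq (v b)))]
  have hX0 : 0 ≤ X := Finset.sum_nonneg fun b _ => nsq_nonneg _
  rcases hX0.eq_or_lt with h0 | h0
  · simp only [← h0, div_zero, mul_zero, Real.exp_zero, avg_const]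
    norm_num
  · have := avg_exp_abs_bilinear A (l := D / X) (by
      calc (D / X) ^ 2 * ∑ a, ∑ b, A a b ^ 2 ≤ (D / X) ^ 2 * (X ^ 2 / (4 * D ^ 2)) := by gcongr
        _ ≤ 1 / 2 := by field_simp; norm_num)
    refine le_trans (le_of_eq ?_) this
    refine congrArg _ (funext fun β => congrArg _ (funext fun α => congrArg _ ?_))
    rw [hchg, abs_mul, abs_two]
    field_simp

/-! ### Sketches as functions of the random bits -/

/-- A finite sequence of bits, continued by `false`. -/
def ext {N : ℕ} (s : Fin N → Bool) : ℕ → Bool := fun i => if h : i < N then s ⟨i, h⟩ else false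

/-- The sequence `f` of vectors after `t` levels. Level `t` uses the bits from `2 * d * t` on, first
`d` bits for the signs `β`, then `d` bits for the signs `α`, and merges at distance `2 ^ t`. -/
noncomputable def sketch {d : ℕ} (D : ℝ) (H : Fin d → Fin d → ℝ) (ω : ℕ → Bool) :
    ℕ → (ℕ → Fin d → ℝ) → ℕ → Fin d → ℝ
  | 0, f => f
  | t + 1, f => mix D H (fun b => ω (2 * d * t + b)) (fun a => ω (2 * d * t + d + a)) (2 ^ t)
      (sketch D H ω t f)

section sketch

variable {d : ℕ} {D : ℝ} {H : Fin d → Fin d → ℝ}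

lemma sketch_congr {ω ω' : ℕ → Bool} (f : ℕ → Fin d → ℝ) :
    ∀ t, (∀ i < 2 * d * t, ω i = ω' i) → sketch D H ω t f = sketch D H ω' t f
  | 0, _ => rfl
  | t + 1, h => by
    have e : 2 * d * (t + 1) = 2 * d * t + 2 * d := by ring
    rw [e] at h
    rw [sketch, sketch, sketch_congr f t fun i hi => h i (by omega)]
    congr 1
    · ext b; exact h _ (by omega)
    · ext a; exact h _ (by omega)

lemma sketch_shift (ω : ℕ → Bool) (f : ℕ → Fin d → ℝ) (c : ℕ) :
    ∀ t, sketch D H ω t (fun p => f (c + p)) = fun p => sketch D H ω t f (c + p)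
  | 0 => rfl
  | t + 1 => by
    rw [sketch, sketch, sketch_shift ω f c t]
    ext p
    simp only [mix, add_assoc]

lemma sketch_sub (ω : ℕ → Bool) (f g : ℕ → Fin d → ℝ) :
    ∀ t, sketch D H ω t (f - g) = sketch D H ω t f - sketch D H ω t g
  | 0 => rfl
  | t + 1 => by
    rw [sketch, sketch, sketch, sketch_sub ω f g t]
    ext p
    simp only [mix, Pi.sub_apply, rot_sub, Pi.add_apply]
    ring

/-- The total energy after `t` levels of the `2 ^ r` vectors that remain of the first
`2 ^ (t + r)`. -/
noncomputable def energy (D : ℝ) (H : Fin d → Fin d → ℝ) (ω : ℕ → Bool) (f : ℕ → Fin d → ℝ)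
    (t r : ℕ) : ℝ :=
  ∑ b ∈ Finset.range (2 ^ r), nsq (sketch D H ω t f (b * 2 ^ t))

/-- The sum of the relative changes of the energy in the first `t` of `k` levels. -/
noncomputable def distortion (D : ℝ) (H : Fin d → Fin d → ℝ) (ω : ℕ → Bool) (f : ℕ → Fin d → ℝ)
    (k t : ℕ) : ℝ :=
  ∑ s ∈ Finset.range t, |energy D H ω f (s + 1) (k - (s + 1)) - energy D H ω f s (k - s)| /
    energy D H ω f s (k - s)

lemma energy_nonneg (ω : ℕ → Bool) (f : ℕ → Fin d → ℝ) (t r : ℕ) : 0 ≤ energy D H ω f t r :=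
  Finset.sum_nonneg fun _ _ => nsq_nonneg _

lemma energy_congr {ω ω' : ℕ → Bool} (f : ℕ → Fin d → ℝ) (t r : ℕ)
    (h : ∀ i < 2 * d * t, ω i = ω' i) : energy D H ω f t r = energy D H ω' f t r := by
  rw [energy, energy, sketch_congr f t h]

lemma distortion_congr {ω ω' : ℕ → Bool} (f : ℕ → Fin d → ℝ) (k t : ℕ)
    (h : ∀ i < 2 * d * t, ω i = ω' i) : distortion D H ω f k t = distortion D H ω' f k t := by
  refine Finset.sum_congr rfl fun s hs => ?_
  have hs' : s + 1 ≤ t := Finset.mem_range.1 hs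
  have h1 : ∀ i < 2 * d * (s + 1), ω i = ω' i := fun i hi =>
    h i (hi.trans_le (Nat.mul_le_mul_left _ hs'))
  have h2 : ∀ i < 2 * d * s, ω i = ω' i := fun i hi =>
    h1 i (hi.trans_le (Nat.mul_le_mul_left _ s.le_succ))
  rw [energy_congr f (s + 1) _ h1, energy_congr f s _ h2]

/-- The levels use disjoint sets of bits, so that the exponential moments of their distortions
multiply. -/
lemma avg_exp_distortion (hH : IsHadamard H) (hD : 0 < D) (hd : D ^ 2 = d) (f : ℕ → Fin d → ℝ)
    (k : ℕ) : ∀ t ≤ k,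
    avg (2 * d * t) (fun s => Real.exp (D / 2 * distortion D H (ext s) f k t)) ≤ 4 ^ t
  | 0, _ => by simp [distortion, avg_const]
  | t + 1, ht => by
    have ih := avg_exp_distortion hH hD hd f k t (by omega)
    have key : ∀ N, N = 2 * d * t + d + d →
        avg N (fun s => Real.exp (D / 2 * distortion D H (ext s) f k (t + 1))) ≤ 4 ^ (t + 1) := by
      rintro N rfl
      rw [avg_append, avg_append]
      have hpt : ∀ (s : Fin (2 * d * t) → Bool) (β α : Fin d → Bool),
          Real.exp (D / 2 * distortion D H (ext (Fin.append (Fin.append s β) α)) f k (t + 1)) =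
          Real.exp (D / 2 * distortion D H (ext s) f k t) * Real.exp (D / 2 *
            (|∑ b ∈ Finset.range (2 ^ (k - (t + 1))), nsq (mix D H β α (2 ^ t)
                (sketch D H (ext s) t f) (b * (2 * 2 ^ t))) -
              ∑ b ∈ Finset.range (2 * 2 ^ (k - (t + 1))),
                nsq (sketch D H (ext s) t f (b * 2 ^ t))| /
              ∑ b ∈ Finset.range (2 * 2 ^ (k - (t + 1))),
                nsq (sketch D H (ext s) t f (b * 2 ^ t)))) := by
        intro s β α
        have hc : ∀ i < 2 * d * t, ext (Fin.append (Fin.append s β) α) i = ext s i := by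
          intro i hi
          have e : (⟨i, by omega⟩ : Fin (2 * d * t + d + d)) =
              Fin.castAdd d (Fin.castAdd d ⟨i, hi⟩) := rfl
          rw [ext, dif_pos (by omega), e, Fin.append_left, Fin.append_left, ext, dif_pos hi]
        have hb : ∀ b : Fin d, ext (Fin.append (Fin.append s β) α) (2 * d * t + b) = β b := by
          intro b
          have e : (⟨2 * d * t + b, by omega⟩ : Fin (2 * d * t + d + d)) =
              Fin.castAdd d (Fin.natAdd (2 * d * t) b) := rfl
          rw [ext, dif_pos (by omega), e, Fin.append_left, Fin.append_right]
        have ha : ∀ a : Fin d, ext (Fin.append (Fin.append s β) α) (2 * d * t + d + a) = α a := by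
          intro a
          have e : (⟨2 * d * t + d + a, by omega⟩ : Fin (2 * d * t + d + d)) =
              Fin.natAdd (2 * d * t + d) a := rfl
          rw [ext, dif_pos (by omega), e, Fin.append_right]
        have hk : 2 ^ (k - t) = 2 * 2 ^ (k - (t + 1)) := by
          rw [← pow_succ', show k - (t + 1) + 1 = k - t by omega]
        rw [← Real.exp_add, ← mul_add]
        congr 2
        rw [distortion, Finset.sum_range_succ]
        congr 1
        · exact distortion_congr f k t hc
        · rw [energy_congr f t _ hc, energy, energy, sketch, sketch_congr f t hc, hk, pow_succ']
          simp only [hb, ha]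
      simp only [hpt, avg_const_mul]
      calc _ ≤ avg (2 * d * t) (fun s => Real.exp (D / 2 * distortion D H (ext s) f k t) * 4) :=
            avg_mono fun s => mul_le_mul_of_nonneg_left
              (avg_exp_energy_change hH hD hd _ _ _) (Real.exp_pos _).le
        _ = avg (2 * d * t) (fun s => 4 * Real.exp (D / 2 * distortion D H (ext s) f k t)) := by
            simp only [mul_comm]
        _ ≤ 4 ^ (t + 1) := by
            rw [avg_const_mul, pow_succ']
            gcongr
    exact key _ (by ring)

end sketch

lemma le_of_relative_changes {x ρ : ℕ → ℝ} (hx : ∀ t, 0 ≤ x t) (hρ : ∀ t, 0 ≤ ρ t) (k : ℕ)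
    (h : ∀ t < k, |x (t + 1) - x t| ≤ ρ t * x t) :
    (1 - ∑ t ∈ Finset.range k, ρ t) * x 0 ≤ x k ∧
      x k ≤ Real.exp (∑ t ∈ Finset.range k, ρ t) * x 0 := by
  induction k with
  | zero => simp
  | succ k ih =>
    obtain ⟨h1, h2⟩ := ih fun t ht => h t (by omega)
    have h3 := abs_le.1 (h k (by omega))
    rw [Finset.sum_range_succ]
    set S := ∑ t ∈ Finset.range k, ρ t
    have hS : 0 ≤ S := Finset.sum_nonneg fun t _ => hρ t
    constructor
    · by_cases hc : ρ k ≤ 1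
      · nlinarith [mul_le_mul_of_nonneg_left h1 (sub_nonneg.2 hc),
          mul_nonneg (mul_nonneg hS (hρ k)) (hx 0)]
      · nlinarith [hx 0, hx (k + 1)]
    · rw [Real.exp_add]
      have := Real.add_one_le_exp (ρ k)
      calc x (k + 1) ≤ (ρ k + 1) * x k := by linarith
        _ ≤ Real.exp (ρ k) * (Real.exp S * x 0) :=
          mul_le_mul this h2 (hx k) (Real.exp_pos _).le
        _ = _ := by ring

lemma exp_half_le {e : ℝ} (h0 : 0 ≤ e) (h1 : e ≤ 1) : Real.exp (e / 2) ≤ 1 + e := by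
  have := Real.abs_exp_sub_one_sub_id_le (x := e / 2) (by rw [abs_of_nonneg] <;> linarith)
  have := (abs_le.1 this).2
  nlinarith

/-- If the total distortion is small, the sketch of the first `2 ^ k` vectors has about their total
energy. -/
lemma nsq_sketch_of_distortion {d : ℕ} {D : ℝ} {H : Fin d → Fin d → ℝ} {ω : ℕ → Bool}
    {f : ℕ → Fin d → ℝ} {k : ℕ} {e : ℝ} (h0 : 0 ≤ e) (h1 : e ≤ 1)
    (h : distortion D H ω f k k ≤ e / 2) :
    (1 - e) * ∑ p ∈ Finset.range (2 ^ k), nsq (f p) ≤ nsq (sketch D H ω k f 0) ∧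
      nsq (sketch D H ω k f 0) ≤ (1 + e) * ∑ p ∈ Finset.range (2 ^ k), nsq (f p) := by
  obtain ⟨h2, h3⟩ := le_of_relative_changes (x := fun t => energy D H ω f t (k - t))
    (ρ := fun s => |energy D H ω f (s + 1) (k - (s + 1)) - energy D H ω f s (k - s)| /
      energy D H ω f s (k - s)) (fun t => energy_nonneg _ _ _ _)
    (fun t => div_nonneg (abs_nonneg _) (energy_nonneg _ _ _ _)) k (fun t ht => by
      rcases eq_or_ne (energy D H ω f t (k - t)) 0 with hz | hz
      · -- without energy at level `t` there is none at level `t + 1`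
        have hk : 2 ^ (k - t) = 2 * 2 ^ (k - (t + 1)) := by
          rw [← pow_succ', show k - (t + 1) + 1 = k - t by omega]
        have hv : ∀ b < 2 * 2 ^ (k - (t + 1)), sketch D H ω t f (b * 2 ^ t) = 0 := by
          intro b hb
          rw [energy, hk, Finset.sum_eq_zero_iff_of_nonneg fun b _ => nsq_nonneg _] at hz
          have := hz b (Finset.mem_range.2 hb)
          rw [nsq, Finset.sum_eq_zero_iff_of_nonneg fun b _ => sq_nonneg _] at this
          ext a
          exact pow_eq_zero_iff (two_ne_zero) |>.1 (this a (Finset.mem_univ _))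
        have : energy D H ω f (t + 1) (k - (t + 1)) = 0 := by
          refine Finset.sum_eq_zero fun b hb => ?_
          have hb := Finset.mem_range.1 hb
          have e1 := hv (2 * b) (by omega)
          have e2 := hv (2 * b + 1) (by omega)
          rw [show 2 * b * 2 ^ t = b * 2 ^ (t + 1) by ring] at e1
          rw [show (2 * b + 1) * 2 ^ t = b * 2 ^ (t + 1) + 2 ^ t by ring] at e2
          simp [sketch, mix, e1, e2, rot_zero, nsq]
        simp [hz, this]
      · rw [div_mul_cancel₀ _ hz])
  have e1 : energy D H ω f 0 (k - 0) = ∑ p ∈ Finset.range (2 ^ k), nsq (f p) := by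
    simp [energy, sketch]
  have e2 : energy D H ω f k (k - k) = nsq (sketch D H ω k f 0) := by
    simp [energy]
  simp only [e1, e2] at h2 h3
  have hn : 0 ≤ ∑ p ∈ Finset.range (2 ^ k), nsq (f p) :=
    Finset.sum_nonneg fun _ _ => nsq_nonneg _
  constructor
  · refine le_trans (mul_le_mul_of_nonneg_right ?_ hn) h2
    change _ ≤ 1 - distortion D H ω f k k
    linarith
  · refine h3.trans (mul_le_mul_of_nonneg_right ?_ hn)
    exact (Real.exp_le_exp.2 h).trans (exp_half_le h0 h1)

/-- Markov's inequality for an event that is decided by the first `N` random bits. -/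
lemma coinMeasure_le_avg (N : ℕ) (B : Set (ℕ → Bool)) (Z : (Fin N → Bool) → ℝ)
    (hZ : ∀ s, 0 ≤ Z s) (hB : ∀ ω ∈ B, 1 ≤ Z fun i => ω i) :
    RAM.coinMeasure B ≤ ENNReal.ofReal (avg N Z) := by
  classical
  have hcyl : ∀ s : Fin N → Bool, RAM.coinMeasure {ω | ∀ i : Fin N, ω i = s i} =
      ENNReal.ofReal (1 / 2 ^ N) := by
    intro s
    have e : {ω : ℕ → Bool | ∀ i : Fin N, ω i = s i} =
        (↑(Finset.range N) : Set ℕ).pi fun i => {ext s i} := by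
      ext ω
      simp only [Set.mem_ofPred_eq, Set.mem_pi, Finset.coe_range, Set.mem_Iio,
        Set.mem_singleton_iff]
      refine ⟨fun h i hi => ?_, fun h i => ?_⟩
      · rw [ext, dif_pos hi]; exact h ⟨i, hi⟩
      · rw [h i i.2, ext, dif_pos i.2]
    rw [e, RAM.coinMeasure, Measure.infinitePi_pi _ fun i _ => MeasurableSet.singleton _]
    simp only [PMF.toMeasure_apply_singleton _ _ (MeasurableSet.singleton _),
      PMF.uniformOfFintype_apply, Finset.prod_const, Finset.card_range, Fintype.card_bool]
    rw [ENNReal.ofReal_div_of_pos (by positivity), ENNReal.ofReal_pow (by norm_num)]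
    simp [ENNReal.inv_pow]
  have hsub : B ⊆ ⋃ s ∈ Finset.univ.filter fun s : Fin N → Bool => 1 ≤ Z s,
      {ω | ∀ i : Fin N, ω i = s i} := by
    intro ω hω
    simp only [Finset.mem_filter, Finset.mem_univ, true_and, Set.mem_iUnion]
    exact ⟨fun i => ω i, hB ω hω, fun i => rfl⟩
  refine (measure_mono hsub).trans ((measure_biUnion_finset_le _ _).trans ?_)
  simp only [hcyl]
  rw [← ENNReal.ofReal_sum_of_nonneg fun _ _ => by positivity]
  refine ENNReal.ofReal_le_ofReal ?_
  rw [avg, Finset.sum_div]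
  calc ∑ s ∈ Finset.univ.filter fun s : Fin N → Bool => 1 ≤ Z s, 1 / (2 : ℝ) ^ N
      ≤ ∑ s ∈ Finset.univ.filter fun s : Fin N → Bool => 1 ≤ Z s, Z s / 2 ^ N := by
        refine Finset.sum_le_sum fun s hs => ?_
        have := (Finset.mem_filter.1 hs).2
        gcongr
    _ ≤ _ := Finset.sum_le_sum_of_subset_of_nonneg (Finset.filter_subset _ _)
        fun s _ _ => div_nonneg (hZ s) (by positivity)

/-- With high probability the sketch of `2 ^ k` vectors preserves their total energy. -/
lemma coinMeasure_nsq_sketch {d : ℕ} {D : ℝ} {H : Fin d → Fin d → ℝ} (hH : IsHadamard H)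
    (hD : 0 < D) (hd : D ^ 2 = d) (f : ℕ → Fin d → ℝ) (k : ℕ) {e : ℝ} (h0 : 0 ≤ e) (h1 : e ≤ 1) :
    RAM.coinMeasure {ω | ¬ ((1 - e) * ∑ p ∈ Finset.range (2 ^ k), nsq (f p) ≤
        nsq (sketch D H ω k f 0) ∧
      nsq (sketch D H ω k f 0) ≤ (1 + e) * ∑ p ∈ Finset.range (2 ^ k), nsq (f p))} ≤
      ENNReal.ofReal (4 ^ k * Real.exp (-(D * e / 4))) := by
  refine (coinMeasure_le_avg (2 * d * k) _
    (fun s => Real.exp (-(D * e / 4)) * Real.exp (D / 2 * distortion D H (ext s) f k k))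
    (fun s => by positivity) fun ω hω => ?_).trans ?_
  · have h2 : e / 2 < distortion D H ω f k k := by
      by_contra hc
      exact hω (nsq_sketch_of_distortion h0 h1 (not_lt.1 hc))
    rw [distortion_congr (ω' := ω) f k k fun i hi => by rw [ext, dif_pos hi], ← Real.exp_add]
    refine Real.one_le_exp ?_
    nlinarith
  · refine ENNReal.ofReal_le_ofReal ?_
    rw [avg_const_mul, mul_comm]
    gcongr
    exact avg_exp_distortion hH hD hd f k k le_rfl

/-! ### The Hadamard transform -/

/-- One pass of the fast Hadamard transform of length `2 * h`. The sums of neighbouring entries go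
to the lower half and the differences to the upper half, so that all passes are the same. -/
def butterfly (h : ℕ) (v : ℕ → ℝ) (a : ℕ) : ℝ :=
  if a < h then v (2 * a) + v (2 * a + 1) else v (2 * (a - h)) - v (2 * (a - h) + 1)

lemma butterfly_congr {h : ℕ} {v w : ℕ → ℝ} (hvw : ∀ a < 2 * h, v a = w a) {a : ℕ}
    (ha : a < 2 * h) : butterfly h v a = butterfly h w a := by
  unfold butterfly
  split
  · rw [hvw _ (by omega), hvw _ (by omega)]
  · rw [hvw _ (by omega), hvw _ (by omega)]

lemma sum_butterfly_sq (h : ℕ) (v : ℕ → ℝ) :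
    ∑ a ∈ Finset.range (2 * h), butterfly h v a ^ 2 = 2 * ∑ a ∈ Finset.range (2 * h), v a ^ 2 := by
  rw [sum_range_two_mul (fun a => v a ^ 2), two_mul h, Finset.sum_range_add, Finset.mul_sum,
    ← Finset.sum_add_distrib]
  refine Finset.sum_congr rfl fun a ha => ?_
  have := Finset.mem_range.1 ha
  simp only [butterfly, this, if_true, Nat.add_sub_cancel_left]
  rw [if_neg (by omega)]
  ring

/-- The entries of the first `l` passes: `l` passes combine `2 ^ l` consecutive entries. -/
lemma exists_signs_butterfly (K : ℕ) : ∀ l ≤ K + 1, ∃ H : ℕ → ℕ → ℝ, (∀ a b, H a b ^ 2 = 1) ∧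
    ∀ (v : ℕ → ℝ) (a : ℕ), a < 2 ^ (K + 1) → (butterfly (2 ^ K))^[l] v a =
      ∑ b ∈ Finset.range (2 ^ l), H a b * v (2 ^ l * (a % 2 ^ (K + 1 - l)) + b)
  | 0, _ => ⟨fun _ _ => 1, by simp, fun v a ha => by simp [Nat.mod_eq_of_lt ha]⟩
  | l + 1, hl => by
    obtain ⟨H, h1, h2⟩ := exists_signs_butterfly K l (by omega)
    have hK : 2 ^ (K + 1) = 2 * 2 ^ K := pow_succ' 2 K
    have hr : 2 ^ (K + 1 - l) = 2 * 2 ^ (K + 1 - (l + 1)) := by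
      rw [← pow_succ', show K + 1 - (l + 1) + 1 = K + 1 - l by omega]
    set R := 2 ^ (K + 1 - (l + 1)) with hR
    have hRpos : 0 < R := by positivity
    have hRK : 2 ^ K = R * 2 ^ l := by
      rw [hR, ← pow_add, show K + 1 - (l + 1) + l = K by omega]
    -- the two entries combined by the last pass
    have hstep : ∀ (v : ℕ → ℝ) (a j : ℕ), j < 2 ^ K → j % R = a % R →
        (butterfly (2 ^ K))^[l] v (2 * j) = ∑ b ∈ Finset.range (2 ^ l),
          H (2 * j) b * v (2 ^ (l + 1) * (a % R) + b) ∧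
        (butterfly (2 ^ K))^[l] v (2 * j + 1) = ∑ b ∈ Finset.range (2 ^ l),
          H (2 * j + 1) b * v (2 ^ (l + 1) * (a % R) + (2 ^ l + b)) := by
      intro v a j hj hja
      rw [h2 v _ (by omega), h2 v _ (by omega), hr, Nat.mul_mod_mul_left]
      have e : (2 * j + 1) % (2 * R) = 2 * (j % R) + 1 := by
        have h3 := Nat.div_add_mod j R
        have h4 := Nat.mod_lt j hRpos
        rw [show 2 * j + 1 = (2 * (j % R) + 1) + 2 * R * (j / R) by nlinarith,
          Nat.add_mul_mod_self_left, Nat.mod_eq_of_lt (by omega)]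
      rw [e, hja]
      constructor <;> refine Finset.sum_congr rfl fun b _ => ?_
      · congr 2; ring
      · congr 2; ring
    refine ⟨fun a b => if b < 2 ^ l then H (2 * (a % 2 ^ K)) b else
      (if a < 2 ^ K then 1 else -1) * H (2 * (a % 2 ^ K) + 1) (b - 2 ^ l), ?_, ?_⟩
    · intro a b
      by_cases hb : b < 2 ^ l
      · simp [hb, h1]
      · by_cases ha : a < 2 ^ K <;> simp [hb, ha, h1]
    · intro v a ha
      rw [Function.iterate_succ_apply', pow_succ', two_mul (2 ^ l), Finset.sum_range_add,
        ← two_mul, ← pow_succ']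
      beta_reduce
      have hmod : a % 2 ^ K % R = a % R := Nat.mod_mod_of_dvd _ ⟨_, hRK⟩
      obtain ⟨s1, s2⟩ := hstep v a (a % 2 ^ K) (Nat.mod_lt _ (by positivity)) hmod
      by_cases hA : a < 2 ^ K
      · rw [Nat.mod_eq_of_lt hA] at s1 s2 ⊢
        rw [butterfly, if_pos hA, s1, s2]
        congr 1
        · refine Finset.sum_congr rfl fun b hb => ?_
          rw [if_pos (Finset.mem_range.1 hb)]
        · refine Finset.sum_congr rfl fun b hb => ?_
          rw [if_neg (by omega), if_pos hA, one_mul, Nat.add_sub_cancel_left]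
      · have e : a % 2 ^ K = a - 2 ^ K := by
          rw [Nat.mod_eq_sub_mod (by omega), Nat.mod_eq_of_lt (by omega)]
        rw [e] at s1 s2 ⊢
        rw [butterfly, if_neg hA, s1, s2, sub_eq_add_neg, ← Finset.sum_neg_distrib]
        congr 1
        · refine Finset.sum_congr rfl fun b hb => ?_
          rw [if_pos (Finset.mem_range.1 hb)]
        · refine Finset.sum_congr rfl fun b hb => ?_
          rw [if_neg (by omega), if_neg hA, Nat.add_sub_cancel_left]
          ring

/-- The fast Hadamard transform is multiplication by a Hadamard matrix. -/
lemma exists_hadamard (L d : ℕ) (hd : d = 2 ^ L) : ∃ H : Fin d → Fin d → ℝ, IsHadamard H ∧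
    ∀ (v : ℕ → ℝ) (a : Fin d), (butterfly (d / 2))^[L] v a = ∑ b : Fin d, H a b * v b := by
  subst hd
  rcases L with _ | K
  · refine ⟨fun _ _ => 1, ⟨by simp, fun v => ?_⟩, fun v a => ?_⟩
    · simp [nsq]
    · simp
  · obtain ⟨H, h1, h2⟩ := exists_signs_butterfly K (K + 1) le_rfl
    have hh : 2 ^ (K + 1) / 2 = 2 ^ K := by rw [pow_succ]; simp
    have h3 : ∀ (v : ℕ → ℝ) (a : Fin (2 ^ (K + 1))),
        (butterfly (2 ^ K))^[K + 1] v a = ∑ b : Fin (2 ^ (K + 1)), H a b * v b := by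
      intro v a
      rw [h2 v a a.2, Nat.sub_self, pow_zero, Nat.mod_one, mul_zero]
      simp only [zero_add]
      exact Finset.sum_range (fun b => H a b * v b)
    have h4 : ∀ (l : ℕ) (v : ℕ → ℝ), ∑ a ∈ Finset.range (2 ^ (K + 1)),
        (butterfly (2 ^ K))^[l] v a ^ 2 =
          (2 : ℝ) ^ l * ∑ a ∈ Finset.range (2 ^ (K + 1)), v a ^ 2 := by
      intro l v
      induction l with
      | zero => simp
      | succ l ih =>
        have := sum_butterfly_sq (2 ^ K) ((butterfly (2 ^ K))^[l] v)
        rw [← pow_succ', ih] at this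
        rw [Function.iterate_succ_apply', this]
        ring
    refine ⟨fun a b => H a b, ⟨fun a b => h1 _ _, fun v => ?_⟩, fun v a => by rw [hh, h3]⟩
    set w : ℕ → ℝ := fun i => if h : i < 2 ^ (K + 1) then v ⟨i, h⟩ else 0 with hw
    have hwv : ∀ b : Fin (2 ^ (K + 1)), w b = v b := fun b => by simp [hw, b.2]
    have h5 := h4 (K + 1) w
    rw [Finset.sum_range, Finset.sum_range] at h5
    simp only [h3, hwv] at h5
    rw [h5, nsq]
    push_cast
    rfl

end Sketch

namespace RAM

/-! ### Reasoning about programs -/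

/-- The registers that a program may write. -/
def Prog.wreg : Prog → List ℕ
  | setReg r _ => [r]
  | flip r => [r]
  | seq c d => c.wreg ++ d.wreg
  | ifLT _ _ c d => c.wreg ++ d.wreg
  | loop r _ c => r :: c.wreg
  | _ => []

/-- The word arrays that a program may write. -/
def Prog.wword : Prog → List ℕ
  | setWord a _ _ => [a]
  | seq c d => c.wword ++ d.wword
  | ifLT _ _ c d => c.wword ++ d.wword
  | loop _ _ c => c.wword
  | _ => []

/-- The data arrays that a program may write. -/
def Prog.wdata : Prog → List ℕ
  | setData a _ _ => [a]
  | seq c d => c.wdata ++ d.wdata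
  | ifLT _ _ c d => c.wdata ++ d.wdata
  | loop _ _ c => c.wdata
  | _ => []

/-- The magnitude arrays that a program may write. -/
def Prog.wmag : Prog → List ℕ
  | setMag a _ _ => [a]
  | seq c d => c.wmag ++ d.wmag
  | ifLT _ _ c d => c.wmag ++ d.wmag
  | loop _ _ c => c.wmag
  | _ => []

/-- Whether a program may use random bits. -/
def Prog.flips : Prog → Bool
  | flip _ => true
  | seq c d => c.flips || d.flips
  | ifLT _ _ c d => c.flips || d.flips
  | loop _ _ c => c.flips
  | _ => false

/-- The state `s'` differs from `s` at most in the memory that `c` may write (and in the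
accounting of time and word sizes). -/
structure Frame (c : Prog) (s s' : State) : Prop where
  reg : ∀ r, r ∉ c.wreg → s'.reg r = s.reg r
  word : ∀ a, a ∉ c.wword → s'.word a = s.word a
  data : ∀ a, a ∉ c.wdata → s'.data a = s.data a
  mag : ∀ a, a ∉ c.wmag → s'.mag a = s.mag a
  coins : c.flips = false → s'.coins = s.coins

lemma Frame.refl (c : Prog) (s : State) : Frame c s s :=
  ⟨fun _ _ => rfl, fun _ _ => rfl, fun _ _ => rfl, fun _ _ => rfl, fun _ => rfl⟩

lemma Frame.trans {c : Prog} {s₁ s₂ s₃ : State} (h : Frame c s₁ s₂) (h' : Frame c s₂ s₃) :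
    Frame c s₁ s₃ :=
  ⟨fun r hr => (h'.reg r hr).trans (h.reg r hr), fun r hr => (h'.word r hr).trans (h.word r hr),
    fun r hr => (h'.data r hr).trans (h.data r hr), fun r hr => (h'.mag r hr).trans (h.mag r hr),
    fun hr => (h'.coins hr).trans (h.coins hr)⟩

lemma Frame.tick {c : Prog} {s s' : State} (t : ℕ) (h : Frame c (s.tick t) s') : Frame c s s' :=
  ⟨h.reg, h.word, h.data, h.mag, h.coins⟩

lemma Frame.mono {c d : Prog} {s s' : State} (h : Frame c s s') (h1 : c.wreg ⊆ d.wreg)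
    (h2 : c.wword ⊆ d.wword) (h3 : c.wdata ⊆ d.wdata) (h4 : c.wmag ⊆ d.wmag)
    (h5 : d.flips = false → c.flips = false) : Frame d s s' :=
  ⟨fun r hr => h.reg r fun x => hr (h1 x), fun r hr => h.word r fun x => hr (h2 x),
    fun r hr => h.data r fun x => hr (h3 x), fun r hr => h.mag r fun x => hr (h4 x),
    fun hr => h.coins (h5 hr)⟩

lemma Frame.loop_body {r : ℕ} {e : WExp} {c : Prog} {s s' : State} (k t : ℕ)
    (h : Frame c ((s.writeReg r k).tick t) s') : Frame (.loop r e c) s s' where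
  reg := fun x hx => by
    simp only [Prog.wreg, List.mem_cons, not_or] at hx
    rw [h.reg x hx.2]
    exact Function.update_of_ne hx.1 _ _
  word := h.word
  data := h.data
  mag := h.mag
  coins := h.coins

lemma Frame.iter {r : ℕ} {e : WExp} {c : Prog} {f : ℕ → State → State}
    (h : ∀ k s, Frame (.loop r e c) s (f k s)) (s : State) :
    ∀ N, Frame (.loop r e c) s (iter f N s)
  | 0 => Frame.refl _ _
  | N + 1 => (Frame.iter h s N).trans (h N _)

lemma Frame.run (ω : ℕ → Bool) : ∀ (c : Prog) (s : State), Frame c s (c.run ω s)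
  | .skip, _ => ⟨fun _ _ => rfl, fun _ _ => rfl, fun _ _ => rfl, fun _ _ => rfl, fun _ => rfl⟩
  | .setReg r e, s => ⟨fun x hx => Function.update_of_ne (by simpa [Prog.wreg] using hx) _ _,
      fun _ _ => rfl, fun _ _ => rfl, fun _ _ => rfl, fun _ => rfl⟩
  | .setWord a i e, s => ⟨fun _ _ => rfl,
      fun x hx => Function.update_of_ne (by simpa [Prog.wword] using hx) _ _,
      fun _ _ => rfl, fun _ _ => rfl, fun _ => rfl⟩
  | .setData a i e, s => ⟨fun _ _ => rfl, fun _ _ => rfl,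
      fun x hx => Function.update_of_ne (by simpa [Prog.wdata] using hx) _ _,
      fun _ _ => rfl, fun _ => rfl⟩
  | .setMag a i e, s => ⟨fun _ _ => rfl, fun _ _ => rfl, fun _ _ => rfl,
      fun x hx => Function.update_of_ne (by simpa [Prog.wmag] using hx) _ _, fun _ => rfl⟩
  | .flip r, s => ⟨fun x hx => Function.update_of_ne (by simpa [Prog.wreg] using hx) _ _,
      fun _ _ => rfl, fun _ _ => rfl, fun _ _ => rfl, fun h => by simp [Prog.flips] at h⟩
  | .seq c d, s =>
      ((Frame.run ω c s).mono (by simp [Prog.wreg]) (by simp [Prog.wword]) (by simp [Prog.wdata])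
        (by simp [Prog.wmag]) (by simp +contextual [Prog.flips])).trans
      ((Frame.run ω d _).mono (by simp [Prog.wreg]) (by simp [Prog.wword]) (by simp [Prog.wdata])
        (by simp [Prog.wmag]) (by simp +contextual [Prog.flips]))
  | .ifLT e f c d, s => by
      rw [Prog.run]
      split
      · exact ((Frame.run ω c _).mono (by simp [Prog.wreg]) (by simp [Prog.wword])
          (by simp [Prog.wdata]) (by simp [Prog.wmag]) (by simp +contextual [Prog.flips])).tick _
      · exact ((Frame.run ω d _).mono (by simp [Prog.wreg]) (by simp [Prog.wword])
          (by simp [Prog.wdata]) (by simp [Prog.wmag]) (by simp +contextual [Prog.flips])).tick _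
  | .loop r e c, s =>
      (Frame.iter (fun k s' => (Frame.run ω c _).loop_body k 1) _ _).tick _

/-- Run from `s` with the random bits `ω`, the program `c` takes at most `t` steps, writes no word
above `B`, and ends in a state with the property `Q`. -/
structure Runs (ω : ℕ → Bool) (B : ℕ) (c : Prog) (s : State) (t : ℕ) (Q : State → Prop) :
    Prop where
  post : Q (c.run ω s)
  time : (c.run ω s).time ≤ s.time + t
  peak : (c.run ω s).peak ≤ max s.peak B

variable {ω : ℕ → Bool} {B : ℕ}

lemma Runs.mono {c : Prog} {s : State} {t t' : ℕ} {Q Q' : State → Prop}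
    (h : Runs ω B c s t Q) (ht : t ≤ t') (hQ : ∀ s', Frame c s s' → Q s' → Q' s') :
    Runs ω B c s t' Q' :=
  ⟨hQ _ (Frame.run ω c s) h.post, h.time.trans (by omega), h.peak⟩

lemma Runs.skip {s : State} {t : ℕ} {Q : State → Prop} (h : Q (s.tick 1)) (ht : 1 ≤ t) :
    Runs ω B .skip s t Q :=
  ⟨h, Nat.add_le_add_left ht _, le_max_left _ _⟩

lemma Runs.setReg {r : ℕ} {e : WExp} {s : State} {t : ℕ} {Q : State → Prop} (he : e.eval s ≤ B)
    (h : Q ((s.writeReg r (e.eval s)).tick (e.size + 1)))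
    (ht : e.size + 1 ≤ t := by exact Nat.le_of_ble_eq_true rfl) :
    Runs ω B (.setReg r e) s t Q :=
  ⟨h, Nat.add_le_add_left ht _, max_le_max le_rfl he⟩

lemma Runs.setWord {a : ℕ} {i e : WExp} {s : State} {t : ℕ} {Q : State → Prop}
    (he : e.eval s ≤ B)
    (h : Q ((s.writeWord a (i.eval s) (e.eval s)).tick (i.size + e.size + 1)))
    (ht : i.size + e.size + 1 ≤ t := by exact Nat.le_of_ble_eq_true rfl) :
    Runs ω B (.setWord a i e) s t Q :=
  ⟨h, Nat.add_le_add_left ht _, max_le_max le_rfl he⟩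

lemma Runs.setData {a : ℕ} {i : WExp} {e : DExp} {s : State} {t : ℕ} {Q : State → Prop}
    (h : Q ((s.writeData a (i.eval s) (e.eval s)).tick (i.size + e.size + 1)))
    (ht : i.size + e.size + 1 ≤ t := by exact Nat.le_of_ble_eq_true rfl) :
    Runs ω B (.setData a i e) s t Q :=
  ⟨h, Nat.add_le_add_left ht _, le_max_left _ _⟩

lemma Runs.setMag {a : ℕ} {i : WExp} {e : MExp} {s : State} {t : ℕ} {Q : State → Prop}
    (h : Q ((s.writeMag a (i.eval s) (e.eval s)).tick (i.size + e.size + 1)))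
    (ht : i.size + e.size + 1 ≤ t := by exact Nat.le_of_ble_eq_true rfl) :
    Runs ω B (.setMag a i e) s t Q :=
  ⟨h, Nat.add_le_add_left ht _, le_max_left _ _⟩

lemma Runs.flip {r : ℕ} {s : State} {Q : State → Prop} (hB : 1 ≤ B)
    (h : Q ((s.flipCoin ω r).tick 1)) : Runs ω B (.flip r) s 1 Q :=
  ⟨h, le_rfl, max_le_max le_rfl ((Bool.toNat_le _).trans hB)⟩

lemma Runs.seq {c d : Prog} {s : State} (t₁ t₂ : ℕ) {t : ℕ} {Q R : State → Prop}
    (h₁ : Runs ω B c s t₁ Q) (h₂ : ∀ s', Frame c s s' → Q s' → Runs ω B d s' t₂ R)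
    (ht : t₁ + t₂ ≤ t := by omega) :
    Runs ω B (.seq c d) s t R := by
  have h := h₂ _ (Frame.run ω c s) h₁.post
  refine ⟨h.post, h.time.trans ?_, h.peak.trans ?_⟩
  · have := h₁.time; omega
  · exact max_le h₁.peak (le_max_right _ _)

lemma Runs.ifLT {e f : WExp} {c d : Prog} {s : State} (t : ℕ) {t' : ℕ} {Q : State → Prop}
    (h₁ : e.eval s < f.eval s → Runs ω B c (s.tick (e.size + f.size + 1)) t Q)
    (h₂ : ¬ e.eval s < f.eval s → Runs ω B d (s.tick (e.size + f.size + 1)) t Q)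
    (ht : e.size + f.size + 1 + t ≤ t') :
    Runs ω B (.ifLT e f c d) s t' Q := by
  by_cases h : e.eval s < f.eval s
  · obtain ⟨p, q, r⟩ := h₁ h
    have e1 : (Prog.ifLT e f c d).run ω s = c.run ω (s.tick (e.size + f.size + 1)) := by
      rw [Prog.run, if_pos h]
    refine ⟨e1 ▸ p, ?_, by rw [e1]; exact r⟩
    rw [e1]
    refine q.trans ?_
    simp only [State.tick]
    omega
  · obtain ⟨p, q, r⟩ := h₂ h
    have e1 : (Prog.ifLT e f c d).run ω s = d.run ω (s.tick (e.size + f.size + 1)) := by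
      rw [Prog.run, if_neg h]
    refine ⟨e1 ▸ p, ?_, by rw [e1]; exact r⟩
    rw [e1]
    refine q.trans ?_
    simp only [State.tick]
    omega

/-- The rule for loops, with an invariant `I`. The body may use that only memory that it writes
has changed since the start of the loop. -/
lemma Runs.loop_sum {r : ℕ} {e : WExp} {c : Prog} {s : State} (I : ℕ → State → Prop) (t : ℕ → ℕ)
    {N : ℕ} (hN : e.eval s = N) (hB : N ≤ B) (h0 : I 0 (s.tick (e.size + 1)))
    (hs : ∀ k < N, ∀ s', Frame (.loop r e c) s s' → I k s' →
      Runs ω B c ((s'.writeReg r k).tick 1) (t k) (I (k + 1))) :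
    Runs ω B (.loop r e c) s (∑ k ∈ Finset.range N, (t k + 1) + (e.size + 1)) (I N) := by
  have key : ∀ M ≤ N, Frame (.loop r e c) s
        (iter (fun k s' => c.run ω ((s'.writeReg r k).tick 1)) M (s.tick (e.size + 1))) ∧
      I M (iter (fun k s' => c.run ω ((s'.writeReg r k).tick 1)) M (s.tick (e.size + 1))) ∧
      (iter (fun k s' => c.run ω ((s'.writeReg r k).tick 1)) M (s.tick (e.size + 1))).time ≤
        s.time + (∑ k ∈ Finset.range M, (t k + 1) + (e.size + 1)) ∧
      (iter (fun k s' => c.run ω ((s'.writeReg r k).tick 1)) M (s.tick (e.size + 1))).peak ≤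
        max s.peak B := by
    intro M
    induction M with
    | zero =>
      intro _
      refine ⟨(Frame.refl _ _).tick _, h0, ?_, le_max_left _ _⟩
      simp [iter, State.tick]
    | succ M ih =>
      intro hM
      obtain ⟨i1, i2, i3, i4⟩ := ih (by omega)
      obtain ⟨p, q, u⟩ := hs M (by omega) _ i1 i2
      refine ⟨i1.trans ((Frame.run ω c _).loop_body M 1), p, q.trans ?_, u.trans ?_⟩
      · rw [Finset.sum_range_succ]
        simp only [State.tick, State.writeReg] at i3 ⊢
        omega
      · simp only [State.tick, State.writeReg] at i4 ⊢
        exact max_le (max_le i4 (by have := le_max_right s.peak B; omega)) (le_max_right _ _)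
  obtain ⟨_, k2, k3, k4⟩ := key N le_rfl
  subst hN
  exact ⟨k2, k3, k4⟩

/-- The rule for loops whose rounds have a common time bound. -/
lemma Runs.loop {r : ℕ} {e : WExp} {c : Prog} {s : State} (I : ℕ → State → Prop) (t N : ℕ)
    {t' : ℕ} {Q : State → Prop}
    (hN : e.eval s = N) (hB : N ≤ B) (h0 : I 0 (s.tick (e.size + 1)))
    (hs : ∀ k < N, ∀ s', Frame (.loop r e c) s s' → I k s' →
      Runs ω B c ((s'.writeReg r k).tick 1) t (I (k + 1)))
    (hQ : ∀ s', Frame (.loop r e c) s s' → I N s' → Q s')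
    (ht : N * (t + 1) + (e.size + 1) ≤ t') :
    Runs ω B (.loop r e c) s t' Q := by
  have := Runs.loop_sum I (fun _ => t) hN hB h0 hs
  refine this.mono ?_ hQ
  simpa using ht

/-! ### Notation for expressions, and the effect of single instructions -/

instance : Add WExp := ⟨WExp.add⟩
instance : Sub WExp := ⟨WExp.sub⟩
instance : Mul WExp := ⟨WExp.mul⟩
instance : Div WExp := ⟨WExp.div⟩
instance (k : ℕ) : OfNat WExp k := ⟨WExp.lit k⟩
instance : Add DExp := ⟨DExp.add⟩
instance : Sub DExp := ⟨DExp.sub⟩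
instance : Add MExp := ⟨MExp.add⟩

section simp_lemmas

variable (s : State) (e f : WExp) (x y : DExp) (u v : MExp)

@[simp] lemma WExp.eval_lit (k : ℕ) : (WExp.lit k).eval s = k := rfl
@[simp] lemma WExp.eval_ofNat (k : ℕ) :
    (no_index (OfNat.ofNat k) : WExp).eval s = OfNat.ofNat k := rfl
@[simp] lemma WExp.eval_reg (r : ℕ) : (WExp.reg r).eval s = s.reg r := rfl
@[simp] lemma WExp.eval_arr (a : ℕ) : (WExp.arr a e).eval s = s.word a (e.eval s) := rfl
@[simp] lemma WExp.eval_add : (e + f).eval s = e.eval s + f.eval s := rfl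
@[simp] lemma WExp.eval_sub : (e - f).eval s = e.eval s - f.eval s := rfl
@[simp] lemma WExp.eval_mul : (e * f).eval s = e.eval s * f.eval s := rfl
@[simp] lemma WExp.eval_div : (e / f).eval s = e.eval s / f.eval s := rfl
@[simp] lemma DExp.eval_arr (a : ℕ) : (DExp.arr a e).eval s = s.data a (e.eval s) := rfl
@[simp] lemma DExp.eval_add : (x + y).eval s = x.eval s + y.eval s := rfl
@[simp] lemma DExp.eval_sub : (x - y).eval s = x.eval s - y.eval s := rfl
@[simp] lemma DExp.eval_mulWord : (DExp.mulWord x e).eval s = x.eval s * (e.eval s : ℝ) := rfl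
@[simp] lemma DExp.eval_divWord : (DExp.divWord x e).eval s = x.eval s / (e.eval s : ℝ) := rfl
@[simp] lemma MExp.eval_arr (a : ℕ) : (MExp.arr a e).eval s = s.mag a (e.eval s) := rfl
@[simp] lemma MExp.eval_sq : (MExp.sq x).eval s = x.eval s ^ 2 := rfl
@[simp] lemma MExp.eval_add : (u + v).eval s = u.eval s + v.eval s := rfl
@[simp] lemma MExp.eval_sqrt : (MExp.sqrt u).eval s = Real.sqrt (u.eval s) := rfl

variable (t r k a i : ℕ) (z : ℝ)

@[simp] lemma State.tick_reg : (s.tick t).reg = s.reg := rfl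
@[simp] lemma State.tick_word : (s.tick t).word = s.word := rfl
@[simp] lemma State.tick_data : (s.tick t).data = s.data := rfl
@[simp] lemma State.tick_mag : (s.tick t).mag = s.mag := rfl
@[simp] lemma State.tick_coins : (s.tick t).coins = s.coins := rfl
@[simp] lemma State.writeReg_reg (j : ℕ) :
    (s.writeReg r k).reg j = if j = r then k else s.reg j := by
  simp [State.writeReg, Function.update_apply]
@[simp] lemma State.writeReg_word : (s.writeReg r k).word = s.word := rfl
@[simp] lemma State.writeReg_data : (s.writeReg r k).data = s.data := rfl
@[simp] lemma State.writeReg_mag : (s.writeReg r k).mag = s.mag := rfl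
@[simp] lemma State.writeReg_coins : (s.writeReg r k).coins = s.coins := rfl
@[simp] lemma State.writeWord_word (b j : ℕ) : (s.writeWord a i k).word b j =
    if b = a ∧ j = i then k else s.word b j := by
  by_cases h : b = a
  · subst h; simp [State.writeWord, Function.update_apply]
  · simp [State.writeWord, h]
@[simp] lemma State.writeWord_reg : (s.writeWord a i k).reg = s.reg := rfl
@[simp] lemma State.writeWord_data : (s.writeWord a i k).data = s.data := rfl
@[simp] lemma State.writeWord_mag : (s.writeWord a i k).mag = s.mag := rfl
@[simp] lemma State.writeWord_coins : (s.writeWord a i k).coins = s.coins := rfl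
@[simp] lemma State.writeData_data (b j : ℕ) : (s.writeData a i z).data b j =
    if b = a ∧ j = i then z else s.data b j := by
  by_cases h : b = a
  · subst h; simp [State.writeData, Function.update_apply]
  · simp [State.writeData, h]
@[simp] lemma State.writeData_reg : (s.writeData a i z).reg = s.reg := rfl
@[simp] lemma State.writeData_word : (s.writeData a i z).word = s.word := rfl
@[simp] lemma State.writeData_mag : (s.writeData a i z).mag = s.mag := rfl
@[simp] lemma State.writeData_coins : (s.writeData a i z).coins = s.coins := rfl
@[simp] lemma State.writeMag_mag (b j : ℕ) : (s.writeMag a i z).mag b j =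
    if b = a ∧ j = i then z else s.mag b j := by
  by_cases h : b = a
  · subst h; simp [State.writeMag, Function.update_apply]
  · simp [State.writeMag, h]
@[simp] lemma State.writeMag_reg : (s.writeMag a i z).reg = s.reg := rfl
@[simp] lemma State.writeMag_word : (s.writeMag a i z).word = s.word := rfl
@[simp] lemma State.writeMag_data : (s.writeMag a i z).data = s.data := rfl
@[simp] lemma State.writeMag_coins : (s.writeMag a i z).coins = s.coins := rfl
@[simp] lemma State.flipCoin_reg (ω : ℕ → Bool) (j : ℕ) :
    (s.flipCoin ω r).reg j = if j = r then (ω s.coins).toNat else s.reg j := by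
  simp [State.flipCoin]
@[simp] lemma State.flipCoin_word (ω : ℕ → Bool) : (s.flipCoin ω r).word = s.word := rfl
@[simp] lemma State.flipCoin_data (ω : ℕ → Bool) : (s.flipCoin ω r).data = s.data := rfl
@[simp] lemma State.flipCoin_mag (ω : ℕ → Bool) : (s.flipCoin ω r).mag = s.mag := rfl
@[simp] lemma State.flipCoin_coins (ω : ℕ → Bool) : (s.flipCoin ω r).coins = s.coins + 1 := rfl

end simp_lemmas

end RAM

namespace Sketch

open RAM RAM.WExp RAM.DExp RAM.Prog

variable {ω : ℕ → Bool} {B : ℕ}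

/-! ### Building blocks of the program -/

/-- Computes a power of two `rP = 2 ^ rE` with `rV ≤ rP < 2 * rV`; the letters stand for registers,
and `rk` is a loop counter. -/
def powAbove (rV rP rE rk : ℕ) : Prog :=
  .seq (.setReg rP 1) <| .seq (.setReg rE 0) <| .loop rk (reg rV) <|
    .ifLT (reg rP) (reg rV) (.seq (.setReg rP (2 * reg rP)) (.setReg rE (reg rE + 1))) .skip

lemma runs_powAbove {rV rP rE rk V : ℕ} {s : State} (hV : s.reg rV = V) (h1 : 1 ≤ V)
    (hB : 2 * V ≤ B) (h : [rV, rP, rE, rk].Nodup) :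
    Runs ω B (powAbove rV rP rE rk) s (12 * V + 6) fun s' =>
      s'.reg rP = 2 ^ s'.reg rE ∧ V ≤ s'.reg rP ∧ s'.reg rP < 2 * V := by
  simp only [List.nodup_cons, List.mem_cons, List.not_mem_nil, or_false, not_or] at h
  obtain ⟨⟨a1, a2, a3⟩, ⟨a4, a5⟩, a6, -⟩ := h
  refine Runs.seq 2 (12 * V + 4) (Q := fun s' => s'.reg rP = 1 ∧ s'.reg rV = V)
    (.setReg (by simp; omega) (by simp [a1, hV])) fun s1 _ h1' => ?_
  refine Runs.seq 2 (12 * V + 2) (Q := fun s' => s'.reg rP = 1 ∧ s'.reg rV = V ∧ s'.reg rE = 0)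
    (.setReg (by simp) (by simp [a2, a4, h1'])) fun s2 _ h2' => ?_
  refine Runs.loop (fun k s' => s'.reg rV = V ∧ s'.reg rP = 2 ^ s'.reg rE ∧ s'.reg rP < 2 * V ∧
      (V ≤ s'.reg rP ∨ s'.reg rE = k)) 11 V (by simp [h2']) (by omega)
    ⟨h2'.2.1, by simp [h2'], by simp [h2']; omega, by simp [h2']⟩ ?_ ?_
    (by simp only [WExp.size]; omega)
  · rintro k hk s' - ⟨i1, i2, i3, i4⟩
    have hE : s'.reg rE < 2 * V := by
      have : s'.reg rE < 2 ^ s'.reg rE := Nat.lt_two_pow_self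
      omega
    refine Runs.ifLT 8 (fun hlt => ?_) (fun hlt => ?_) (Nat.le_of_ble_eq_true rfl)
    · simp [i1, a5, a3] at hlt
      refine Runs.seq 4 4 (Q := fun s'' => s''.reg rV = V ∧ s''.reg rP = 2 * s'.reg rP ∧
        s''.reg rE = s'.reg rE) (.setReg (by simp [a5]; omega)
        (by simp [a1, a3, a5, a6, Ne.symm a4, i1])) fun s3 _ h3 => ?_
      refine .setReg (by simp [h3]; omega) ?_
      have hk : s'.reg rE = k := by omega
      simp [h3, a2, a4, i2]
      rw [← pow_succ', hk]
      rw [i2, hk] at hlt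
      exact ⟨rfl, hlt, Or.inr rfl⟩
    · simp [i1, a5, a3] at hlt
      refine Runs.skip ?_ (by decide)
      simp [a3, a5, a6, i1, i2]
      rw [i2] at hlt i3
      exact ⟨i3, Or.inl hlt⟩
  · rintro s' - ⟨i1, i2, i3, i4⟩
    refine ⟨i2, ?_, i3⟩
    rcases i4 with i4 | i4
    · exact i4
    · rw [i2, i4]
      exact Nat.lt_two_pow_self.le

/-- One pass of the Hadamard transform on the data array `3`, of the length in register `7`. -/
def hadamardPass : Prog :=
  .seq
    (.loop 19 (reg 7 / 2) <| .seq
      (.setData 4 (reg 19) (DExp.arr 3 (2 * reg 19) + DExp.arr 3 (2 * reg 19 + 1)))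
      (.setData 4 (reg 19 + reg 7 / 2) (DExp.arr 3 (2 * reg 19) - DExp.arr 3 (2 * reg 19 + 1))))
    (.loop 19 (reg 7) <| .setData 3 (reg 19) (DExp.arr 4 (reg 19)))

lemma runs_hadamardPass {s : State} {h : ℕ} (h7 : s.reg 7 = 2 * h) (hB : 2 * h ≤ B) :
    Runs ω B hadamardPass s (41 * h + 6) fun s' =>
      ∀ a < 2 * h, s'.data 3 a = butterfly h (s.data 3) a := by
  refine Runs.seq (31 * h + 4) (10 * h + 2) (Q := fun s' => ∀ a < 2 * h,
    s'.data 4 a = butterfly h (s.data 3) a) ?_ fun s1 f1 h1 => ?_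
  · refine Runs.loop (fun k s' => ∀ a < k, s'.data 4 a = butterfly h (s.data 3) a ∧
        s'.data 4 (a + h) = butterfly h (s.data 3) (a + h)) 30 h (by simp [h7]) (by omega)
      (by simp) ?_ ?_ (by change _ + 4 ≤ _; omega)
    · intro k hk s' f' I
      have e7 : s'.reg 7 = 2 * h := (f'.reg 7 (by decide)).trans h7
      have e3 : s'.data 3 = s.data 3 := f'.data 3 (by decide)
      refine Runs.seq 13 17 (Q := fun s'' => s''.data 4 k = butterfly h (s.data 3) k ∧
        (∀ a, a ≠ k → s''.data 4 a = s'.data 4 a) ∧ s''.reg 19 = k ∧ s''.reg 7 = 2 * h ∧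
        s''.data 3 = s.data 3) (.setData ⟨?_, ?_, ?_⟩) fun s2 f2 ⟨q1, q2, q3, q4, q5⟩ =>
          .setData fun a ha => ?_
      · simp [butterfly, hk, e3]
      · intro a ha
        simp [ha]
      · refine ⟨by simp, by simp [e7], ?_⟩
        ext a
        simp [e3]
      · have e : butterfly h (s.data 3) (k + h) =
            s.data 3 (2 * k) - s.data 3 (2 * k + 1) := by
          rw [butterfly, if_neg (by omega), Nat.add_sub_cancel]
        rcases Nat.lt_succ_iff_lt_or_eq.1 ha with ha | rfl
        · have h1 := I a ha
          simp [q3, q4, q5, show a ≠ k + h by omega, show a ≠ k by omega,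
            q2 a (by omega), q2 (a + h) (by omega), h1]
        · simp [q1, q3, q4, q5, show h ≠ 0 by omega, e]
    · intro s' _ I a ha
      by_cases hah : a < h
      · exact (I a hah).1
      · have := (I (a - h) (by omega)).2
        rwa [Nat.sub_add_cancel (by omega)] at this
  · have e7 : s1.reg 7 = 2 * h := (f1.reg 7 (by decide)).trans h7
    refine Runs.loop (fun k s' => ∀ a < k, s'.data 3 a = butterfly h (s.data 3) a) 4 (2 * h)
      (by simp [e7]) hB (by simp) ?_ (fun s' _ I => I) (by change _ + 2 ≤ _; omega)
    intro k hk s' f' I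
    have e4 : s'.data 4 = s1.data 4 := f'.data 4 (by decide)
    refine .setData fun a ha => ?_
    rcases Nat.lt_succ_iff_lt_or_eq.1 ha with ha | rfl
    · simp [show a ≠ k by omega, I a ha]
    · simp [e4, h1 a hk]

/-- The Hadamard transform of the data array `3`, of length `reg 7 = 4 ^ reg 6`. -/
def hadamard : Prog := .loop 18 (2 * reg 6) hadamardPass

lemma runs_hadamard {s : State} {d l : ℕ} (h6 : s.reg 6 = l) (h7 : s.reg 7 = d)
    (hd : d = 2 ^ (2 * l)) (hB : d ≤ B) (hl : 2 * l ≤ B) :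
    Runs ω B hadamard s (48 * l * d + 2 * l + 4) fun s' =>
      ∀ a < d, s'.data 3 a = (butterfly (d / 2))^[2 * l] (s.data 3) a := by
  refine Runs.loop (fun k s' => ∀ a < d, s'.data 3 a = (butterfly (d / 2))^[k] (s.data 3) a)
    (24 * d) (2 * l) (by simp [h6]) hl (fun _ _ => rfl) ?_ (fun s' _ I => I)
    (by change _ + 4 ≤ _; nlinarith)
  intro k hk s' f' I
  have h2 : d = 2 * (d / 2) := by
    have : d = 2 * 2 ^ (2 * l - 1) := by
      rw [hd, ← pow_succ', show 2 * l - 1 + 1 = 2 * l by omega]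
    omega
  have e7 : s'.reg 7 = d := (f'.reg 7 (by decide)).trans h7
  have hd0 : 0 < d := by rw [hd]; positivity
  refine (runs_hadamardPass (h := d / 2) (by simp [e7, ← h2]) (by omega)).mono (by omega) ?_
  intro s'' _ h a ha
  rw [h a (by omega), Function.iterate_succ_apply']
  exact butterfly_congr (fun a ha => by simpa using I a (by omega)) (by omega)

/-- The vectors of length `d` that are stored consecutively in the array `x`. -/
def slots (d : ℕ) (x : ℕ → ℝ) (p : ℕ) : Fin d → ℝ := fun a => x (p * d + a)

/-- In the data array `A`, adds to the vector that starts at `reg 15` the rotation of the one that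
starts at `reg 16`. The signs of the rotation are in the word arrays `0` and `1`, its normalization
in register `5`. -/
def merge (A : ℕ) : Prog :=
  .seq (.loop 17 (reg 7) <| .setData 3 (reg 17) <|
    DExp.arr A (reg 16 + reg 17) -
      mulWord (DExp.arr A (reg 16 + reg 17)) (2 * WExp.arr 0 (reg 17))) <|
  .seq hadamard <| .loop 17 (reg 7) <| .setData A (reg 15 + reg 17) <|
    DExp.arr A (reg 15 + reg 17) + divWord
      (DExp.arr 3 (reg 17) - mulWord (DExp.arr 3 (reg 17)) (2 * WExp.arr 1 (reg 17))) (reg 5)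

/-- What the program knows about its parameters: `d` is the length of the vectors, `H` the matrix of
the Hadamard transform, and `D = √d` and `l = log₂ D` are in the registers `5` and `6`. -/
structure Params (B d D l : ℕ) (H : Fin d → Fin d → ℝ) : Prop where
  d_eq : d = 2 ^ (2 * l)
  D_eq : D = 2 ^ l
  d_le : d ≤ B
  l_le : 2 * l ≤ B
  fly : ∀ (v : ℕ → ℝ) (a : Fin d), (butterfly (d / 2))^[2 * l] v a = ∑ b, H a b * v b

/-- The parameters are in their registers. -/
structure HasParams (d D l : ℕ) (s : State) : Prop where
  r5 : s.reg 5 = D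
  r6 : s.reg 6 = l
  r7 : s.reg 7 = d

lemma HasParams.of_frame {d D l : ℕ} {c : Prog} {s s' : State} (h : HasParams d D l s)
    (f : Frame c s s') (h5 : 5 ∉ c.wreg := by decide) (h6 : 6 ∉ c.wreg := by decide)
    (h7 : 7 ∉ c.wreg := by decide) : HasParams d D l s' :=
  ⟨(f.reg _ h5).trans h.r5, (f.reg _ h6).trans h.r6, (f.reg _ h7).trans h.r7⟩

/-- The signs of a rotation are in the word arrays `0` and `1`. -/
structure HasSigns {d : ℕ} (β α : Fin d → Bool) (s : State) : Prop where
  w0 : ∀ b : Fin d, s.word 0 b = (β b).toNat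
  w1 : ∀ a : Fin d, s.word 1 a = (α a).toNat

lemma HasSigns.of_frame {d : ℕ} {β α : Fin d → Bool} {c : Prog} {s s' : State}
    (h : HasSigns β α s) (f : Frame c s s') (h0 : 0 ∉ c.wword := by decide)
    (h1 : 1 ∉ c.wword := by decide) : HasSigns β α s' :=
  ⟨fun b => by rw [f.word 0 h0, h.w0], fun a => by rw [f.word 1 h1, h.w1]⟩

/-- How the program multiplies by a random sign: products with words are allowed, but words are not
negative. -/
lemma sub_mul_bit (x : ℝ) (b : Bool) : x - x * ((2 * b.toNat : ℕ) : ℝ) = sgn b * x := by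
  cases b <;> simp
  ring

variable {d D l : ℕ} {H : Fin d → Fin d → ℝ} {β α : Fin d → Bool}

lemma Params.d_pos (hP : Params B d D l H) : 0 < d := by rw [hP.d_eq]; positivity

lemma runs_merge {A : ℕ} (hA3 : A ≠ 3) (hA4 : A ≠ 4) {s : State} (hP : Params B d D l H)
    (hs : HasParams d D l s) (hw : HasSigns β α s) {p p' : ℕ} (h15 : s.reg 15 = p * d)
    (h16 : s.reg 16 = p' * d) :
    Runs ω B (merge A) s (50 * d * (l + 1)) fun s' =>
      slots d (s'.data A) = Function.update (slots d (s.data A)) p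
        (slots d (s.data A) p + rot D H β α (slots d (s.data A) p')) := by
  have hd0 := hP.d_pos
  refine Runs.seq (17 * d + 2) (48 * l * d + 2 * l + 4 + (22 * d + 2)) (Q := fun s' =>
    ∀ b : Fin d, s'.data 3 b = sgn (β b) * slots d (s.data A) p' b) ?_ (fun s1 f1 h1 => ?_)
    (by nlinarith)
  · refine Runs.loop (fun k s' => ∀ b : Fin d, (b : ℕ) < k →
        s'.data 3 b = sgn (β b) * slots d (s.data A) p' b) 16 d (by simp [hs.r7]) hP.d_le (by simp)
      ?_ (fun s' _ I b => I b b.2) (by change _ + 2 ≤ _; omega)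
    intro k hk s' f' I
    have eA : s'.data A = s.data A := f'.data A (by simp [Prog.wdata, hA3])
    have ew : s'.word 0 = s.word 0 := f'.word 0 (by simp [Prog.wword])
    have e16 : s'.reg 16 = p' * d := (f'.reg 16 (by simp [Prog.wreg])).trans h16
    refine .setData (fun b hb => ?_)
    rcases Nat.lt_succ_iff_lt_or_eq.1 hb with hb | hb
    · simp [show (b : ℕ) ≠ k by omega, I b hb]
    · subst hb
      simp [eA, ew, e16, hw.w0 b]
      rw [← sub_mul_bit]
      simp [slots]
  · have f1' : s1.data A = s.data A := f1.data A (by simp [Prog.wdata, hA3])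
    have hs1 : HasParams d D l s1 := hs.of_frame f1 (by simp [Prog.wreg]) (by simp [Prog.wreg])
      (by simp [Prog.wreg])
    refine Runs.seq _ _ (runs_hadamard hs1.r6 hs1.r7 hP.d_eq hP.d_le hP.l_le)
      (fun s2 f2 h2 => ?_) le_rfl
    have e2A : s2.data A = s.data A :=
      (f2.data A (by simp [hadamard, hadamardPass, Prog.wdata, hA3, hA4])).trans f1'
    have hs2 : HasParams d D l s2 := hs1.of_frame f2
    have hw2 : HasSigns β α s2 :=
      (hw.of_frame f1 (by simp [Prog.wword]) (by simp [Prog.wword])).of_frame f2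
        (by decide) (by decide)
    have e15 : s2.reg 15 = p * d := (f2.reg 15 (by decide)).trans
      ((f1.reg 15 (by simp [Prog.wreg])).trans h15)
    have h3 : ∀ a : Fin d, s2.data 3 a = ∑ b, H a b * (sgn (β b) * slots d (s.data A) p' b) := by
      intro a
      rw [h2 a a.2, hP.fly]
      simp only [h1]
    refine Runs.loop (fun k s' => ∀ idx, s'.data A idx = s.data A idx +
        if h : p * d ≤ idx ∧ idx < p * d + k ∧ idx - p * d < d then
          rot D H β α (slots d (s.data A) p') ⟨idx - p * d, h.2.2⟩ else 0) 21 d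
      (by simp [hs2.r7]) hP.d_le (fun idx => ?_) ?_ (fun s' _ I => ?_) (by change _ + 2 ≤ _; omega)
    · rw [dif_neg (by omega)]
      simp [e2A]
    · intro k hk s' f' I
      have e3 : s'.data 3 = s2.data 3 := f'.data 3 (by simp [Prog.wdata, hA3.symm])
      have ew : s'.word 1 = s2.word 1 := f'.word 1 (by simp [Prog.wword])
      have e15' : s'.reg 15 = p * d := (f'.reg 15 (by simp [Prog.wreg])).trans e15
      have e5 : s'.reg 5 = D := (f'.reg 5 (by simp [Prog.wreg])).trans hs2.r5
      refine .setData (fun idx => ?_)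
      by_cases hidx : idx = p * d + k
      · subst hidx
        have := I (p * d + k)
        rw [dif_neg (by omega)] at this
        rw [dif_pos ⟨by omega, by omega, by omega⟩]
        have hw' := hw2.w1 ⟨k, hk⟩
        have h3' := h3 ⟨k, hk⟩
        simp only at hw' h3'
        simp [e15', this, e3, ew, e5, hw']
        have e := sub_mul_bit (s2.data 3 k) (α ⟨k, hk⟩)
        push_cast at e
        rw [e, h3', rot]
      · have := I idx
        by_cases hc : p * d ≤ idx ∧ idx < p * d + k ∧ idx - p * d < d
        · rw [dif_pos hc] at this
          rw [dif_pos ⟨hc.1, by omega, hc.2.2⟩]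
          simp [e15', hidx, this]
        · rw [dif_neg hc] at this
          rw [dif_neg (by omega)]
          simp [e15', hidx, this]
    · funext q
      ext a
      have ha := a.2
      rw [slots, I]
      by_cases hq : q = p
      · subst hq
        rw [Function.update_self, dif_pos ⟨by omega, by omega, by omega⟩]
        simp [slots]
      · rw [Function.update_of_ne hq, dif_neg, add_zero]
        · rfl
        · rintro ⟨g1, g2, -⟩
          rcases lt_or_gt_of_ne hq with hlt | hlt
          · have := Nat.mul_le_mul_right d (Nat.succ_le_of_lt hlt)
            rw [Nat.succ_mul] at this
            omega
          · have := Nat.mul_le_mul_right d (Nat.succ_le_of_lt hlt)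
            rw [Nat.succ_mul] at this
            omega

/-- Fills the word arrays `0` and `1` with random bits. -/
def drawSigns : Prog :=
  .seq (.loop 13 (reg 7) <| .seq (.flip 14) (.setWord 0 (reg 13) (reg 14)))
    (.loop 13 (reg 7) <| .seq (.flip 14) (.setWord 1 (reg 13) (reg 14)))

lemma runs_drawSigns_loop {w : ℕ} {s : State} (h7 : s.reg 7 = d) (hd : d ≤ B) (hB : 1 ≤ B) :
    Runs ω B (.loop 13 (reg 7) <| .seq (.flip 14) (.setWord w (reg 13) (reg 14))) s (5 * d + 2)
      fun s' => s'.coins = s.coins + d ∧ ∀ b < d, s'.word w b = (ω (s.coins + b)).toNat := by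
  refine Runs.loop (fun k s' => s'.coins = s.coins + k ∧
      ∀ b < k, s'.word w b = (ω (s.coins + b)).toNat) 4 d (by simp [h7]) hd (by simp) ?_
    (fun s' _ I => I) (by change _ + 2 ≤ _; omega)
  rintro k hk s' - ⟨i1, i2⟩
  refine Runs.seq 1 3 (Q := fun s'' => s''.coins = s.coins + (k + 1) ∧ s''.reg 13 = k ∧
    s''.reg 14 = (ω (s.coins + k)).toNat ∧ s''.word = s'.word)
    (.flip hB ⟨by simp [i1]; ring, by simp, by simp [i1], by simp⟩) ?_
  rintro s'' - ⟨j1, j2, j3, j4⟩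
  refine .setWord (by simp [j3]; exact (Bool.toNat_le _).trans hB) ⟨by simp [j1], fun b hb => ?_⟩
  rcases Nat.lt_succ_iff_lt_or_eq.1 hb with hb | rfl
  · simp [j2, show b ≠ k by omega, j4, i2 b hb]
  · simp [j2, j3]

lemma runs_drawSigns {s : State} (h7 : s.reg 7 = d) (hd : d ≤ B) (hB : 1 ≤ B) :
    Runs ω B drawSigns s (10 * d + 4) fun s' => s'.coins = s.coins + 2 * d ∧
      HasSigns (fun b : Fin d => ω (s.coins + b)) (fun a : Fin d => ω (s.coins + d + a)) s' := by
  refine Runs.seq (5 * d + 2) (5 * d + 2) (runs_drawSigns_loop h7 hd hB) fun s1 f1 ⟨h1, h2⟩ => ?_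
  refine (runs_drawSigns_loop ((f1.reg 7 (by decide)).trans h7) hd hB).mono le_rfl ?_
  rintro s2 f2 ⟨h3, h4⟩
  refine ⟨by omega, fun b => ?_, fun a => ?_⟩
  · rw [f2.word 0 (by decide), h2 b b.2]
  · rw [h4 a a.2, h1]

/-! ### The treatment of all windows -/

/-- One level of the sketch of the text, whose vectors are in the data array `0`; register `9` holds
the distance at which vectors are merged. -/
def mergeText : Prog :=
  .loop 20 (reg 0 / reg 7 + 1) <| .seq (.setReg 15 (reg 20 * reg 7)) <|
    .seq (.setReg 16 ((reg 20 + reg 9) * reg 7)) (merge 0)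

lemma runs_mergeText {s : State} (hP : Params B d D l H) (hs : HasParams d D l s)
    (hw : HasSigns β α s) {n h : ℕ} (h0 : s.reg 0 = n) (h9 : s.reg 9 = h)
    (hB : n + (h + 1) * d ≤ B) (hz : ∀ p, n / d < p → slots d (s.data 0) p = 0) :
    Runs ω B mergeText s (61 * (n + d) * (l + 1) + 6) fun s' =>
      slots d (s'.data 0) = mix D H β α h (slots d (s.data 0)) := by
  have hd0 := hP.d_pos
  have hnd : n / d * d ≤ n := Nat.div_mul_le_self n d
  have hn : n / d ≤ n := Nat.div_le_self n d
  refine Runs.loop (fun k s' => slots d (s'.data 0) = fun p =>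
      if p < k then mix D H β α h (slots d (s.data 0)) p else slots d (s.data 0) p)
    (10 + 50 * d * (l + 1)) (n / d + 1) (by simp [h0, hs.r7]) (by nlinarith) (by simp) ?_ ?_ ?_
  · intro k hk s' f' I
    have g0 : HasParams d D l s' := hs.of_frame f'
    have g1 : HasSigns β α s' := hw.of_frame f'
    have g9 : s'.reg 9 = h := (f'.reg 9 (by decide)).trans h9
    have hkd : k * d ≤ n := (Nat.mul_le_mul_right d (by omega)).trans hnd
    refine Runs.seq 4 (6 + 50 * d * (l + 1)) (Q := fun s'' => s''.reg 15 = k * d ∧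
      s''.reg 20 = k ∧ s''.data 0 = s'.data 0)
      (.setReg (by simp [g0.r7]; nlinarith) (by simp [g0.r7])) fun s1 f1 h1 => ?_
    have k0 : HasParams d D l s1 := ⟨by rw [f1.reg 5 (by decide)]; simp [g0.r5],
      by rw [f1.reg 6 (by decide)]; simp [g0.r6], by rw [f1.reg 7 (by decide)]; simp [g0.r7]⟩
    have k9 : s1.reg 9 = h := by rw [f1.reg 9 (by decide)]; simp [g9]
    have kw : s1.word = s'.word := by
      funext x; rw [f1.word x (by simp [Prog.wword])]; simp
    refine Runs.seq 6 (50 * d * (l + 1)) (Q := fun s'' => s''.reg 15 = k * d ∧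
      s''.reg 16 = (k + h) * d ∧ s''.data 0 = s'.data 0)
      (.setReg (by simp [h1, k0.r7, k9]; nlinarith) (by simp [h1, k9, k0.r7]))
      fun s2 f2 ⟨h2, h3, h4⟩ => ?_
    refine (runs_merge (by decide) (by decide) hP (k0.of_frame f2)
      ((⟨fun b => by rw [kw, g1.w0], fun a => by rw [kw, g1.w1]⟩ :
        HasSigns β α s1).of_frame f2) h2 h3).mono le_rfl fun s3 _ h5 => ?_
    rw [h5, h4, I]
    funext p
    by_cases hp : p = k
    · subst hp
      simp [mix]
    · rw [Function.update_of_ne hp]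
      by_cases hpk : p < k
      · simp [hpk, show p < k + 1 by omega]
      · simp [hpk, show ¬ p < k + 1 by omega]
  · intro s' _ I
    rw [I]
    funext p
    by_cases hp : p < n / d + 1
    · simp [hp]
    · simp only [if_neg hp, mix]
      rw [hz p (by omega), hz (p + h) (by omega), rot_zero, add_zero]
  · change _ + 6 ≤ _
    have h1 : (n / d + 1) * d ≤ n + d := by rw [Nat.add_mul, one_mul]; omega
    have h2 : 10 + 50 * d * (l + 1) + 1 ≤ 61 * d * (l + 1) := by nlinarith
    calc (n / d + 1) * (10 + 50 * d * (l + 1) + 1) + 6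
        ≤ (n / d + 1) * (61 * d * (l + 1)) + 6 := by gcongr
      _ = 61 * ((n / d + 1) * d) * (l + 1) + 6 := by ring
      _ ≤ _ := by gcongr

/-- One level of the sketch of the pattern, for all its `reg 7` alignments to the blocks of the
text: the vectors of the alignment `r` are those from `r * reg 8` on in the data array `2`. -/
def mergePattern : Prog :=
  .loop 20 (reg 7) <| .loop 21 (reg 8 / (2 * reg 9)) <|
    .seq (.setReg 15 ((reg 20 * reg 8 + reg 21 * (2 * reg 9)) * reg 7)) <|
    .seq (.setReg 16 (reg 15 + reg 9 * reg 7)) (merge 2)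

lemma eq_of_add_mul_eq {M r r' p p' : ℕ} (hp : p < M) (hp' : p' < M)
    (h : r * M + p = r' * M + p') : r = r' ∧ p = p' := by
  have hM : 0 < M := by omega
  have e1 : (r * M + p) / M = r := by
    rw [mul_comm, Nat.mul_add_div hM, Nat.div_eq_of_lt hp, add_zero]
  have e2 : (r' * M + p') / M = r' := by
    rw [mul_comm, Nat.mul_add_div hM, Nat.div_eq_of_lt hp', add_zero]
  have : r = r' := by rw [← e1, h, e2]
  subst this
  exact ⟨rfl, by omega⟩

lemma runs_mergePattern {s : State} (hP : Params B d D l H) (hs : HasParams d D l s)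
    (hw : HasSigns β α s) {M h : ℕ} (h8 : s.reg 8 = M) (h9 : s.reg 9 = h) (hh : 0 < h)
    (hB : d * M * d ≤ B) (F : ℕ → ℕ → Fin d → ℝ)
    (hF : ∀ r < d, ∀ b < M / h, slots d (s.data 2) (r * M + b * h) = F r (b * h)) :
    Runs ω B mergePattern s (69 * d * d * (l + 1) * (M / (2 * h)) + 7 * d + 2) fun s' =>
      ∀ r < d, ∀ b < M / (2 * h),
        slots d (s'.data 2) (r * M + b * (2 * h)) = mix D H β α h (F r) (b * (2 * h)) := by
  have hd0 := hP.d_pos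
  set K := M / (2 * h) with hK
  have hKM : K * (2 * h) ≤ M := Nat.div_mul_le_self _ _
  have hK2 : 2 * K ≤ M / h := (Nat.le_div_iff_mul_le hh).2 (by nlinarith)
  have hMh : M / h * h ≤ M := Nat.div_mul_le_self _ _
  have hKB : K ≤ B := by
    have a1 : K ≤ M := Nat.div_le_self _ _
    have a2 : M ≤ d * M * d := by nlinarith [Nat.mul_le_mul (Nat.succ_le_of_lt hd0) hd0]
    omega
  refine Runs.loop (fun k s' =>
      (∀ r < d, k ≤ r → ∀ b < M / h, slots d (s'.data 2) (r * M + b * h) = F r (b * h)) ∧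
      (∀ r < k, ∀ b < K, slots d (s'.data 2) (r * M + b * (2 * h)) =
        mix D H β α h (F r) (b * (2 * h))))
    (69 * d * (l + 1) * K + 6) d (by simp [hs.r7]) hP.d_le ⟨fun r hr _ b hb => hF r hr b hb,
      by simp⟩ ?_ (fun s' _ I => I.2) (by change _ + 2 ≤ _; nlinarith)
  rintro k hk s' f' ⟨I1, I2⟩
  have g0 : HasParams d D l s' := hs.of_frame f'
  have g1 : HasSigns β α s' := hw.of_frame f'
  have g9 : s'.reg 9 = h := (f'.reg 9 (by decide)).trans h9
  have g8 : s'.reg 8 = M := (f'.reg 8 (by decide)).trans h8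
  refine Runs.loop (fun j s'' =>
      (∀ b < j, slots d (s''.data 2) (k * M + b * (2 * h)) =
        mix D H β α h (F k) (b * (2 * h))) ∧
      ∀ p, (∀ b < j, p ≠ k * M + b * (2 * h)) → slots d (s''.data 2) p = slots d (s'.data 2) p)
    (18 + 50 * d * (l + 1)) K (by simp [g8, g9, hK]) hKB ⟨by simp, by simp⟩ ?_ ?_
      (by change _ + 6 ≤ _; nlinarith [mul_pos hd0 (Nat.succ_pos l)])
  · rintro j hj s1 f1 ⟨J1, J2⟩
    have k0 : HasParams d D l s1 := ⟨by rw [f1.reg 5 (by decide)]; simp [g0.r5],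
      by rw [f1.reg 6 (by decide)]; simp [g0.r6], by rw [f1.reg 7 (by decide)]; simp [g0.r7]⟩
    have k8 : s1.reg 8 = M := by rw [f1.reg 8 (by decide)]; simp [g8]
    have k9 : s1.reg 9 = h := by rw [f1.reg 9 (by decide)]; simp [g9]
    have k20 : s1.reg 20 = k := by rw [f1.reg 20 (by decide)]; simp
    have kw : HasSigns β α s1 := ⟨fun b => by rw [f1.word 0 (by decide)]; simp [g1.w0],
      fun b => by rw [f1.word 1 (by decide)]; simp [g1.w1]⟩
    have hjM : j * (2 * h) + 2 * h ≤ M := by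
      have := (Nat.mul_le_mul_right (2 * h) (Nat.succ_le_of_lt hj)).trans hKM
      rwa [Nat.succ_mul] at this
    have hkM : k * M + M ≤ d * M := by
      have := Nat.mul_le_mul_right M (Nat.succ_le_of_lt hk)
      rwa [Nat.succ_mul] at this
    have hpd : (k * M + j * (2 * h) + h) * d ≤ B :=
      (Nat.mul_le_mul_right d (by omega)).trans hB
    refine Runs.seq 12 (6 + 50 * d * (l + 1)) (Q := fun s'' =>
      s''.reg 15 = (k * M + j * (2 * h)) * d ∧ s''.data 2 = s1.data 2)
      (.setReg (by simp [k0.r7, k8, k9, k20]; exact (Nat.mul_le_mul_right d (by omega)).trans hpd)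
        (by simp [k0.r7, k8, k9, k20])) fun s2 f2 h2 => ?_
    have l0 : HasParams d D l s2 := ⟨by rw [f2.reg 5 (by decide)]; simp [k0.r5],
      by rw [f2.reg 6 (by decide)]; simp [k0.r6], by rw [f2.reg 7 (by decide)]; simp [k0.r7]⟩
    have l9 : s2.reg 9 = h := by rw [f2.reg 9 (by decide)]; simp [k9]
    have lw : HasSigns β α s2 := ⟨fun b => by rw [f2.word 0 (by decide)]; simp [kw.w0],
      fun b => by rw [f2.word 1 (by decide)]; simp [kw.w1]⟩
    refine Runs.seq 6 (50 * d * (l + 1)) (Q := fun s'' =>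
      s''.reg 15 = (k * M + j * (2 * h)) * d ∧ s''.reg 16 = (k * M + j * (2 * h) + h) * d ∧
      s''.data 2 = s1.data 2)
      (.setReg (by simp [l0.r7, l9, h2]; rwa [← Nat.add_mul])
        (by simp [l0.r7, l9, h2]; ring)) fun s3 f3 ⟨h3, h4, h5⟩ => ?_
    refine (runs_merge (by decide) (by decide) hP (l0.of_frame f3) (lw.of_frame f3) h3 h4).mono
      le_rfl fun s4 _ h6 => ?_
    rw [h6, h5]
    constructor
    · intro b hb
      rcases Nat.lt_succ_iff_lt_or_eq.1 hb with hb | rfl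
      · rw [Function.update_of_ne, J1 b hb]
        intro hc
        have : b * (2 * h) < j * (2 * h) := Nat.mul_lt_mul_of_pos_right hb (by omega)
        omega
      · -- the two vectors merged still have their old values
        have hne : ∀ q, b * (2 * h) ≤ q → ∀ b' < b, k * M + q ≠ k * M + b' * (2 * h) := by
          intro q hq b' hb' hc
          have : b' * (2 * h) < b * (2 * h) := Nat.mul_lt_mul_of_pos_right hb' (by omega)
          omega
        have e1 := I1 k hk le_rfl (2 * b) (by omega)
        have e2 := I1 k hk le_rfl (2 * b + 1) (by omega)
        rw [show 2 * b * h = b * (2 * h) by ring] at e1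
        rw [show (2 * b + 1) * h = b * (2 * h) + h by ring] at e2
        rw [Function.update_self, J2 _ (hne _ le_rfl), add_assoc,
          J2 _ (hne (b * (2 * h) + h) (by omega)), e1, e2]
        rfl
    · intro p hp
      rw [Function.update_of_ne (hp j (by omega)), J2 p fun b hb => hp b (by omega)]
  · rintro s'' - ⟨J1, J2⟩
    refine ⟨fun r hr hkr b hb => ?_, fun r hr b hb => ?_⟩
    · have hbM : b * h < M := (Nat.mul_lt_mul_of_pos_right hb hh).trans_le hMh
      rw [J2, I1 r hr (by omega) b hb]
      intro b' hb' hc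
      have hbM' : b' * (2 * h) < M :=
        (Nat.mul_lt_mul_of_pos_right hb' (by omega)).trans_le hKM
      have := (eq_of_add_mul_eq hbM hbM' hc).1
      omega
    · rcases Nat.lt_succ_iff_lt_or_eq.1 hr with hr | rfl
      · have hbM : b * (2 * h) < M :=
          (Nat.mul_lt_mul_of_pos_right hb (by omega)).trans_le hKM
        rw [J2, I2 r hr b hb]
        intro b' hb' hc
        have hbM' : b' * (2 * h) < M :=
          (Nat.mul_lt_mul_of_pos_right hb' (by omega)).trans_le hKM
        have := (eq_of_add_mul_eq hbM hbM' hc).1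
        omega
      · exact J1 b hb

/-- The number of the first block of length `d` of the text that starts at `i` or later. -/
def blk (d i : ℕ) : ℕ := (i + d - 1) / d

/-- The distance from `i` to the start of that block. -/
def gap (d i : ℕ) : ℕ := blk d i * d - i

lemma blk_mul_le (hd : 0 < d) (i : ℕ) : i ≤ blk d i * d ∧ blk d i * d + 1 ≤ i + d := by
  have h1 := Nat.div_add_mod (i + d - 1) d
  have h2 := Nat.mod_lt (i + d - 1) hd
  rw [mul_comm] at h1
  unfold blk
  omega

/-- The start, among the blocks of a window, of the piece that the binary digit `h` (a power of two)
of the number `M` of blocks stands for. -/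
def pieceStart (M h : ℕ) : ℕ := (M / h - 1) * h

/-- Adds, for all windows, the energy of the sketch of one piece to the output. -/
def addPiece : Prog :=
  .loop 10 (reg 0 + 1 - reg 1) <|
    .seq (.setReg 22 ((reg 8 / reg 9 - 1) * reg 9)) <|
    .seq (.setReg 23 ((reg 10 + reg 7 - 1) / reg 7)) <|
    .seq (.setReg 15 ((reg 23 + reg 22) * reg 7)) <|
    .seq (.setReg 16 (((reg 23 * reg 7 - reg 10) * reg 8 + reg 22) * reg 7)) <|
    .loop 11 (reg 7) <| .setMag 0 (reg 10) <|
      MExp.arr 0 (reg 10) + .sq (DExp.arr 0 (reg 15 + reg 11) - DExp.arr 2 (reg 16 + reg 11))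

lemma runs_addPiece {s : State} (hd : 0 < d) {n m M h : ℕ} (h0 : s.reg 0 = n) (h1 : s.reg 1 = m)
    (h7 : s.reg 7 = d) (h8 : s.reg 8 = M) (h9 : s.reg 9 = h) (hm : 1 ≤ m) (hM : 0 < M)
    (hB : n + d + M * d ≤ B) (hB' : d * M * d ≤ B) :
    Runs ω B addPiece s (53 * n * d + 6) fun s' => ∀ i < n + 1 - m, s'.mag 0 i = s.mag 0 i +
      nsq (slots d (s.data 0) (blk d i + pieceStart M h) -
        slots d (s.data 2) (gap d i * M + pieceStart M h)) := by
  have ho : pieceStart M h ≤ M :=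
    (Nat.mul_le_mul_right h (Nat.sub_le _ _)).trans (Nat.div_mul_le_self _ _)
  have hMd : M ≤ M * d := Nat.le_mul_of_pos_right M hd
  refine Runs.loop (fun k s' => ∀ i, s'.mag 0 i = s.mag 0 i + if i < k then
      nsq (slots d (s.data 0) (blk d i + pieceStart M h) -
        slots d (s.data 2) (gap d i * M + pieceStart M h)) else 0)
    (36 + 16 * d) (n + 1 - m) (by simp [h0, h1]) (by omega) (by simp) ?_
    (fun s' _ I i hi => by rw [I i, if_pos hi]) ?_
  · intro k hk s' f' I
    have g7 : s'.reg 7 = d := (f'.reg 7 (by decide)).trans h7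
    have g8 : s'.reg 8 = M := (f'.reg 8 (by decide)).trans h8
    have g9 : s'.reg 9 = h := (f'.reg 9 (by decide)).trans h9
    have gd0 : s'.data 0 = s.data 0 := f'.data 0 (by decide)
    have gd2 : s'.data 2 = s.data 2 := f'.data 2 (by decide)
    obtain ⟨b1, b2⟩ := blk_mul_le hd k
    have hod : pieceStart M h * d ≤ M * d := Nat.mul_le_mul_right d ho
    have hblk : blk d k ≤ blk d k * d := Nat.le_mul_of_pos_right _ hd
    have hgap : gap d k + 1 ≤ d := by unfold gap; omega
    refine Runs.seq 8 (28 + 16 * d) (Q := fun s'' => s''.reg 22 = pieceStart M h ∧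
      s''.reg 10 = k ∧ s''.reg 7 = d ∧ s''.reg 8 = M ∧ s''.data = s'.data ∧ s''.mag = s'.mag)
      (.setReg (by simp [g8, g9]; change pieceStart M h ≤ B; omega)
        ⟨by simp [g8, g9, pieceStart], by simp, by simp [g7], by simp [g8], by simp, by simp⟩)
      fun s1 _ ⟨q1, q2, q3, q4, q5, q6⟩ => ?_
    refine Runs.seq 8 (20 + 16 * d) (Q := fun s'' => s''.reg 22 = pieceStart M h ∧
      s''.reg 10 = k ∧ s''.reg 7 = d ∧ s''.reg 8 = M ∧ s''.data = s'.data ∧ s''.mag = s'.mag ∧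
      s''.reg 23 = blk d k)
      (.setReg (by simp [q2, q3]; change blk d k ≤ B; omega)
        ⟨by simp [q1], by simp [q2], by simp [q3], by simp [q4], by simp [q5], by simp [q6],
          by simp [q2, q3, blk]⟩)
      fun s2 _ ⟨u1, u2, u3, u4, u5, u6, u7⟩ => ?_
    refine Runs.seq 6 (14 + 16 * d) (Q := fun s'' => s''.reg 22 = pieceStart M h ∧
      s''.reg 10 = k ∧ s''.reg 7 = d ∧ s''.reg 8 = M ∧ s''.data = s'.data ∧ s''.mag = s'.mag ∧
      s''.reg 23 = blk d k ∧ s''.reg 15 = (blk d k + pieceStart M h) * d)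
      (.setReg (by simp [u1, u3, u7]; rw [Nat.add_mul]; omega)
        ⟨by simp [u1], by simp [u2], by simp [u3], by simp [u4], by simp [u5], by simp [u6],
          by simp [u7], by simp [u1, u3, u7]⟩)
      fun s3 _ ⟨v1, v2, v3, v4, v5, v6, v7, v8⟩ => ?_
    have hgp : (gap d k * M + pieceStart M h) * d ≤ B := by
      have : gap d k * M + pieceStart M h ≤ d * M := by
        have := Nat.mul_le_mul_right M hgap
        rw [Nat.succ_mul] at this
        omega
      exact (Nat.mul_le_mul_right d this).trans hB'
    refine Runs.seq 12 (2 + 16 * d) (Q := fun s'' =>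
      s''.reg 10 = k ∧ s''.reg 7 = d ∧ s''.data = s'.data ∧ s''.mag = s'.mag ∧
      s''.reg 15 = (blk d k + pieceStart M h) * d ∧
      s''.reg 16 = (gap d k * M + pieceStart M h) * d)
      (.setReg (by simp [v1, v2, v3, v4, v7]; exact hgp)
        ⟨by simp [v2], by simp [v3], by simp [v5], by simp [v6],
          by simp [v8], by simp [v1, v2, v3, v4, v7, gap]⟩)
      fun s4 _ ⟨w1, w2, w3, w4, w5, w6⟩ => ?_
    refine Runs.loop (fun j s'' => ∀ i, s''.mag 0 i = s'.mag 0 i + if i = k then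
        ∑ a ∈ Finset.range j, (s.data 0 ((blk d k + pieceStart M h) * d + a) -
          s.data 2 ((gap d k * M + pieceStart M h) * d + a)) ^ 2 else 0) 15 d
      (by simp [w2]) (by omega) (fun i => by simp [w4]) ?_ (fun s'' _ J i => ?_)
      (by change _ + 2 ≤ _; omega)
    · intro j hj s5 f5 J
      have x10 : s5.reg 10 = k := (f5.reg 10 (by decide)).trans w1
      have x15 := (f5.reg 15 (by decide)).trans w5
      have x16 := (f5.reg 16 (by decide)).trans w6
      have xd0 : s5.data 0 = s.data 0 := by rw [f5.data 0 (by decide), w3, gd0]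
      have xd2 : s5.data 2 = s.data 2 := by rw [f5.data 2 (by decide), w3, gd2]
      refine .setMag fun i => ?_
      by_cases hi : i = k
      · subst hi
        simp [x10, x15, x16, xd0, xd2, J i, Finset.sum_range_succ, add_assoc]
      · simp [x10, hi, J i]
    · rw [J i, I i]
      by_cases hi : i = k
      · subst hi
        simp only [lt_irrefl, if_false, add_zero, if_true, Nat.lt_succ_self]
        congr 1
        rw [Finset.sum_range]
        rfl
      · rw [if_neg hi, add_zero]
        congr 1
        by_cases hik : i < k
        · rw [if_pos hik, if_pos (by omega)]
        · rw [if_neg hik, if_neg (by omega)]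
  · change _ + 6 ≤ _
    have : n + 1 - m ≤ n := by omega
    calc (n + 1 - m) * (36 + 16 * d + 1) + 6 ≤ n * (53 * d) + 6 := by gcongr; omega
      _ = _ := by ring

/-- Lays out the blocks of the pattern for all alignments in the data array `2`. -/
def copyPattern : Prog :=
  .loop 20 (reg 7) <| .loop 11 (reg 8 * reg 7) <|
    .setData 2 (reg 20 * (reg 8 * reg 7) + reg 11) (DExp.arr 1 (reg 20 + reg 11))

lemma runs_copyPattern {s : State} {M : ℕ} (h7 : s.reg 7 = d) (h8 : s.reg 8 = M)
    (hd : d ≤ B) (hB : M * d ≤ B) :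
    Runs ω B copyPattern s (13 * (M * d) * d + 5 * d + 2) fun s' =>
      ∀ r < d, ∀ p < M, ∀ a : Fin d, slots d (s'.data 2) (r * M + p) a =
        s.data 1 (r + p * d + a) := by
  refine Runs.loop (fun k s' => ∀ r < k, ∀ x < M * d,
      s'.data 2 (r * (M * d) + x) = s.data 1 (r + x)) (13 * (M * d) + 4) d (by simp [h7]) hd
    (by simp) ?_ (fun s' _ I r hr p hp a => ?_) (by change _ + 2 ≤ _; nlinarith)
  · intro k hk s' f' I
    have g7 : s'.reg 7 = d := (f'.reg 7 (by decide)).trans h7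
    have g8 : s'.reg 8 = M := (f'.reg 8 (by decide)).trans h8
    have gd : s'.data 1 = s.data 1 := f'.data 1 (by decide)
    refine Runs.loop (fun j s'' => (∀ r < k, ∀ x < M * d,
        s''.data 2 (r * (M * d) + x) = s.data 1 (r + x)) ∧
        ∀ x < j, s''.data 2 (k * (M * d) + x) = s.data 1 (k + x)) 12 (M * d)
      (by simp [g7, g8]) hB ⟨I, by simp⟩ ?_ (fun s'' _ J r hr => ?_) (by change _ + 4 ≤ _; omega)
    · rintro j hj s1 f1 ⟨J1, J2⟩
      have k7 : s1.reg 7 = d := by rw [f1.reg 7 (by decide)]; simp [g7]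
      have k8 : s1.reg 8 = M := by rw [f1.reg 8 (by decide)]; simp [g8]
      have k20 : s1.reg 20 = k := by rw [f1.reg 20 (by decide)]; simp
      have kd : s1.data 1 = s.data 1 := by rw [f1.data 1 (by decide)]; simp [gd]
      refine .setData ⟨fun r hr x hx => ?_, fun x hx => ?_⟩
      · have : r * (M * d) + x ≠ k * (M * d) + j := fun hc => by
          have := (eq_of_add_mul_eq hx hj hc).1
          omega
        simp [k7, k8, k20, this, J1 r hr x hx]
      · rcases Nat.lt_succ_iff_lt_or_eq.1 hx with hx | rfl
        · simp [k7, k8, k20, show x ≠ j by omega, J2 x hx]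
        · simp [k7, k8, k20, kd]
    · rcases Nat.lt_succ_iff_lt_or_eq.1 hr with hr | rfl
      · exact J.1 r hr
      · exact J.2
  · have hx : p * d + a < M * d := by
      have := a.2
      nlinarith
    have := I r hr (p * d + a) hx
    rw [slots, add_assoc, ← this]
    congr 1
    ring

/-- The `j`-th of the letters of a window that are outside its `M` full blocks. -/
def outer (d M i j : ℕ) : ℕ := if j < gap d i then j else j + M * d

/-- Adds, for all windows, the squared distance on the letters outside the full blocks. -/
def addOuter : Prog :=
  .loop 10 (reg 0 + 1 - reg 1) <|
    .seq (.setReg 23 ((reg 10 + reg 7 - 1) / reg 7 * reg 7 - reg 10)) <|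
    .loop 11 (reg 1 - reg 8 * reg 7) <|
      .seq (.ifLT (reg 11) (reg 23) (.setReg 24 (reg 11)) (.setReg 24 (reg 11 + reg 8 * reg 7))) <|
      .setMag 0 (reg 10) <|
        MExp.arr 0 (reg 10) + .sq (DExp.arr 0 (reg 10 + reg 24) - DExp.arr 1 (reg 24))

lemma runs_addOuter {s : State} (hd : 0 < d) {n m M : ℕ} (h0 : s.reg 0 = n) (h1 : s.reg 1 = m)
    (h7 : s.reg 7 = d) (h8 : s.reg 8 = M) (hm : 1 ≤ m) (hmn : m ≤ n) (hB : n + d + M * d ≤ B) :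
    Runs ω B addOuter s (n * (19 + 23 * (m - M * d)) + 6) fun s' => ∀ i < n + 1 - m,
      s'.mag 0 i = s.mag 0 i + ∑ j ∈ Finset.range (m - M * d),
        (s.data 0 (i + outer d M i j) - s.data 1 (outer d M i j)) ^ 2 := by
  refine Runs.loop (fun k s' => ∀ i, s'.mag 0 i = s.mag 0 i + if i < k then
      ∑ j ∈ Finset.range (m - M * d),
        (s.data 0 (i + outer d M i j) - s.data 1 (outer d M i j)) ^ 2 else 0)
    (18 + 23 * (m - M * d)) (n + 1 - m) (by simp [h0, h1]) (by omega) (by simp) ?_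
    (fun s' _ I i hi => by rw [I i, if_pos hi]) ?_
  · intro k hk s' f' I
    have g1 : s'.reg 1 = m := (f'.reg 1 (by decide)).trans h1
    have g7 : s'.reg 7 = d := (f'.reg 7 (by decide)).trans h7
    have g8 : s'.reg 8 = M := (f'.reg 8 (by decide)).trans h8
    have gd0 : s'.data 0 = s.data 0 := f'.data 0 (by decide)
    have gd1 : s'.data 1 = s.data 1 := f'.data 1 (by decide)
    obtain ⟨b1, b2⟩ := blk_mul_le hd k
    refine Runs.seq 12 (23 * (m - M * d) + 6) (Q := fun s'' => s''.reg 23 = gap d k ∧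
      s''.reg 10 = k ∧ s''.reg 1 = m ∧ s''.reg 7 = d ∧ s''.reg 8 = M ∧ s''.data = s'.data ∧
      s''.mag = s'.mag)
      (.setReg (by simp [g7]; change blk d k * d ≤ B + k; omega)
        ⟨by simp [g7, gap, blk], by simp, by simp [g1], by simp [g7], by simp [g8], by simp,
          by simp⟩)
      fun s1 _ ⟨q1, q2, q3, q4, q5, q6, q7⟩ => ?_
    refine Runs.loop (fun j s'' => ∀ i, s''.mag 0 i = s'.mag 0 i + if i = k then
        ∑ j ∈ Finset.range j,
          (s.data 0 (k + outer d M k j) - s.data 1 (outer d M k j)) ^ 2 else 0) 22 (m - M * d)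
      (by simp [q3, q4, q5]) (by omega) (fun i => by simp [q7]) ?_ (fun s'' _ J i => ?_)
      (by change _ + 6 ≤ _; omega)
    · intro j hj s2 f2 J
      have x10 : s2.reg 10 = k := (f2.reg 10 (by decide)).trans q2
      have x23 : s2.reg 23 = gap d k := (f2.reg 23 (by decide)).trans q1
      have x7 : s2.reg 7 = d := (f2.reg 7 (by decide)).trans q4
      have x8 : s2.reg 8 = M := (f2.reg 8 (by decide)).trans q5
      have xd0 : s2.data 0 = s.data 0 := by rw [f2.data 0 (by decide), q6, gd0]
      have xd1 : s2.data 1 = s.data 1 := by rw [f2.data 1 (by decide), q6, gd1]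
      refine Runs.seq 9 13 (Q := fun s'' => s''.reg 24 = outer d M k j ∧ s''.reg 10 = k ∧
        s''.data = s2.data ∧ s''.mag = s2.mag) ?_ fun s3 _ ⟨y1, y2, y3, y4⟩ => .setMag fun i => ?_
      · refine Runs.ifLT 6 (fun hlt => ?_) (fun hlt => ?_) (Nat.le_of_ble_eq_true rfl)
        · simp [x23] at hlt
          exact .setReg (by simp; omega) ⟨by simp [outer, hlt], by simp [x10], by simp, by simp⟩
        · simp [x23] at hlt
          exact .setReg (by simp [x7, x8]; omega)
            ⟨by simp [outer, hlt, x7, x8], by simp [x10], by simp, by simp⟩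
      · by_cases hi : i = k
        · subst hi
          simp [y1, y2, y3, y4, xd0, xd1, J i, Finset.sum_range_succ, add_assoc]
        · simp [y2, y4, hi, J i]
    · rw [J i, I i]
      by_cases hi : i = k
      · subst hi
        simp
      · rw [if_neg hi, add_zero]
        congr 1
        by_cases hik : i < k
        · rw [if_pos hik, if_pos (by omega)]
        · rw [if_neg hik, if_neg (by omega)]
  · change _ + 6 ≤ _
    have : n + 1 - m ≤ n := by omega
    exact Nat.add_le_add_right (Nat.mul_le_mul this (by omega)) 6

/-- Takes the square roots of the outputs. -/
def rootOutput : Prog :=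
  .loop 10 (reg 0 + 1 - reg 1) <| .setMag 0 (reg 10) (.sqrt (.arr 0 (reg 10)))

lemma runs_rootOutput {s : State} {n m : ℕ} (h0 : s.reg 0 = n) (h1 : s.reg 1 = m) (hm : 1 ≤ m)
    (hB : n ≤ B) : Runs ω B rootOutput s (6 * n + 6) fun s' => ∀ i < n + 1 - m,
      s'.mag 0 i = Real.sqrt (s.mag 0 i) := by
  refine Runs.loop (fun k s' => ∀ i, s'.mag 0 i =
      if i < k then Real.sqrt (s.mag 0 i) else s.mag 0 i) 5 (n + 1 - m) (by simp [h0, h1])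
    (by omega) (by simp) ?_ (fun s' _ I i hi => by rw [I i, if_pos hi])
    (by change _ + 6 ≤ _; omega)
  intro k hk s' _ I
  refine .setMag fun i => ?_
  by_cases hi : i = k
  · subst hi
    simp [I i]
  · simp [hi, I i, show i < k + 1 ↔ i < k by omega]

/-! ### The main loop and the whole program -/

/-- The round of the main loop for one binary digit of the number of blocks of a window. -/
def level : Prog :=
  .seq (.ifLT (2 * (reg 8 / reg 9 / 2)) (reg 8 / reg 9) addPiece .skip) <|
  .seq drawSigns <| .seq mergeText <| .seq mergePattern (.setReg 9 (2 * reg 9))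

/-- The contribution to the output for the window `i` of the binary digit `k` of the number `M` of
its blocks. The sequences `fT` and `fP r` are the blocks of the text and, for the alignment `r`, of
the pattern. -/
noncomputable def pieceEnergy (D : ℝ) (H : Fin d → Fin d → ℝ) (ω : ℕ → Bool) (fT : ℕ → Fin d → ℝ)
    (fP : ℕ → ℕ → Fin d → ℝ) (M i k : ℕ) : ℝ :=
  if M / 2 ^ k % 2 = 1 then
    nsq (sketch D H ω k fT (blk d i + pieceStart M (2 ^ k)) -
      sketch D H ω k (fP (gap d i)) (pieceStart M (2 ^ k)))
  else 0

/-- The invariant of the main loop. -/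
structure AtLevel (ω : ℕ → Bool) (D : ℕ) (H : Fin d → Fin d → ℝ) (n m M : ℕ) (fT : ℕ → Fin d → ℝ)
    (fP : ℕ → ℕ → Fin d → ℝ) (e : ℕ → ℝ) (t : ℕ) (s : State) : Prop where
  r9 : s.reg 9 = 2 ^ t
  coins : s.coins = 2 * d * t
  text : slots d (s.data 0) = sketch D H ω t fT
  pattern : ∀ r < d, ∀ b < M / 2 ^ t,
    slots d (s.data 2) (r * M + b * 2 ^ t) = sketch D H ω t (fP r) (b * 2 ^ t)
  mag : ∀ i < n + 1 - m, s.mag 0 i = e i + ∑ k ∈ Finset.range t, pieceEnergy D H ω fT fP M i k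

lemma sketch_eq_zero {f : ℕ → Fin d → ℝ} {N : ℕ} {D : ℝ} (hf : ∀ p, N < p → f p = 0) :
    ∀ (t p : ℕ), N < p → sketch D H ω t f p = 0
  | 0, p, hp => hf p hp
  | t + 1, p, hp => by
    rw [sketch, mix, sketch_eq_zero hf t p hp, sketch_eq_zero hf t _ (Nat.lt_add_right _ hp),
      rot_zero, add_zero]

lemma gap_lt (hd : 0 < d) (i : ℕ) : gap d i < d := by
  have := blk_mul_le hd i
  unfold gap
  omega

lemma runs_level {n m M t : ℕ} {fT : ℕ → Fin d → ℝ} {fP : ℕ → ℕ → Fin d → ℝ} {e : ℕ → ℝ}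
    {s : State} (hP : Params B d D l H) (hs : HasParams d D l s) (h0 : s.reg 0 = n)
    (h1 : s.reg 1 = m) (h8 : s.reg 8 = M) (hm : 1 ≤ m) (hz : ∀ p, n / d < p → fT p = 0)
    (hB : n + d + M * d ≤ B) (hB' : d * M * d ≤ B) (ht : n + (2 ^ t + 1) * d ≤ B)
    (ht' : 2 * 2 ^ t ≤ B) (hI : AtLevel ω D H n m M fT fP e t s) :
    Runs ω B level s (53 * n * d + 17 * d + 61 * (n + d) * (l + 1) + 33 +
      69 * d * d * (l + 1) * (M / (2 * 2 ^ t))) (AtLevel ω D H n m M fT fP e (t + 1)) := by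
  have hd := hP.d_pos
  have hdB := hP.d_le
  have h9 := hI.r9
  refine Runs.seq (53 * n * d + 17) (10 * d + 4 + (61 * (n + d) * (l + 1) + 6 +
      (69 * d * d * (l + 1) * (M / (2 * 2 ^ t)) + 7 * d + 2 + 4)))
    (Q := fun s' => ∀ i < n + 1 - m, s'.mag 0 i = s.mag 0 i + pieceEnergy D H ω fT fP M i t)
    ?_ fun s1 f1 q1 => ?_
  · refine Runs.ifLT (53 * n * d + 6) (fun hlt => ?_) (fun hlt => ?_)
      (by change 11 + _ ≤ _; omega)
    · simp [h8, h9] at hlt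
      have hne : M / 2 ^ t % 2 = 1 := by omega
      have hpos : 1 ≤ M / 2 ^ t := by omega
      have hM : 0 < M := by
        rcases Nat.eq_zero_or_pos M with h | h
        · simp [h] at hpos
        · exact h
      have := runs_addPiece (ω := ω) (h := 2 ^ t)
        (s := s.tick ((2 * (reg 8 / reg 9 / 2) : WExp).size + (reg 8 / reg 9 : WExp).size + 1))
        hd h0 h1 hs.r7 h8 h9 hm hM hB hB'
      refine this.mono le_rfl fun s' _ q i hi => ?_
      rw [q i hi, pieceEnergy, if_pos hne]
      simp only [State.tick_data, State.tick_mag]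
      rw [hI.text]
      have hb : M / 2 ^ t - 1 < M / 2 ^ t := by omega
      have := hI.pattern (gap d i) (gap_lt hd i) _ hb
      rw [pieceStart, this]
    · simp [h8, h9] at hlt
      refine Runs.skip (fun i hi => ?_) (by omega)
      rw [pieceEnergy, if_neg (by omega), add_zero]
      rfl
  · have g0 : HasParams d D l s1 := hs.of_frame f1
    have gd0 : s1.data 0 = s.data 0 := f1.data 0 (by decide)
    have gd2 : s1.data 2 = s.data 2 := f1.data 2 (by decide)
    have gc : s1.coins = 2 * d * t := (f1.coins rfl).trans hI.coins
    refine Runs.seq _ _ (runs_drawSigns g0.r7 hdB (by omega)) (fun s2 f2 ⟨c2, w2⟩ => ?_) le_rfl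
    rw [gc] at c2 w2
    have k0 : HasParams d D l s2 := g0.of_frame f2
    have kd0 : s2.data 0 = s.data 0 := (f2.data 0 (by decide)).trans gd0
    have kd2 : s2.data 2 = s.data 2 := (f2.data 2 (by decide)).trans gd2
    have k0n : s2.reg 0 = n := (f2.reg 0 (by decide)).trans ((f1.reg 0 (by decide)).trans h0)
    have k8 : s2.reg 8 = M := (f2.reg 8 (by decide)).trans ((f1.reg 8 (by decide)).trans h8)
    have k9 : s2.reg 9 = 2 ^ t := (f2.reg 9 (by decide)).trans ((f1.reg 9 (by decide)).trans h9)
    refine Runs.seq _ _ (runs_mergeText hP k0 w2 k0n k9 ht (fun p hp => by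
      rw [kd0, hI.text]; exact sketch_eq_zero hz t p hp)) (fun s3 f3 q3 => ?_) le_rfl
    have l0 : HasParams d D l s3 := k0.of_frame f3
    have ld2 : s3.data 2 = s.data 2 := (f3.data 2 (by decide)).trans kd2
    have lw : HasSigns _ _ s3 := w2.of_frame f3
    refine Runs.seq _ _ (runs_mergePattern hP l0 lw ((f3.reg 8 (by decide)).trans k8)
      ((f3.reg 9 (by decide)).trans k9) (by positivity) hB' (fun r => sketch D H ω t (fP r))
      (fun r hr b hb => by rw [ld2]; exact hI.pattern r hr b hb)) (fun s4 f4 q4 => ?_) le_rfl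
    have m9 : s4.reg 9 = 2 ^ t := (f4.reg 9 (by decide)).trans ((f3.reg 9 (by decide)).trans k9)
    refine .setReg (by simpa [m9] using ht') ⟨by simp [m9, pow_succ'], ?_, ?_, ?_, ?_⟩
    · simp only [State.tick_coins, State.writeReg_coins]
      rw [f4.coins rfl, f3.coins rfl, c2]
      ring
    · simp only [State.tick_data, State.writeReg_data]
      rw [f4.data 0 (by decide), q3, kd0, hI.text]
      rfl
    · intro r hr b hb
      rw [pow_succ'] at hb ⊢
      exact q4 r hr b hb
    · intro i hi
      simp only [State.tick_mag, State.writeReg_mag]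
      rw [f4.mag 0 (by decide), f3.mag 0 (by decide), f2.mag 0 (by decide), q1 i hi, hI.mag i hi,
        Finset.sum_range_succ, add_assoc]

lemma sum_div_two_pow_le (M k : ℕ) :
    ∑ t ∈ Finset.range k, M / (2 * 2 ^ t) + M / 2 ^ k ≤ M := by
  induction k with
  | zero => simp
  | succ k ih =>
    rw [Finset.sum_range_succ, pow_succ']
    have : M / (2 * 2 ^ k) = M / 2 ^ k / 2 := by rw [mul_comm, Nat.div_div_eq_div_mul]
    omega

/-- The part of the program that treats the full blocks of the windows. -/
def sketchBlocks : Prog :=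
  .seq copyPattern <| .seq (.setReg 9 1) <| .loop 12 (reg 3) level

lemma runs_sketchBlocks {n m M lg : ℕ} {s : State} (hP : Params B d D l H)
    (hs : HasParams d D l s) (h0 : s.reg 0 = n) (h1 : s.reg 1 = m) (h3 : s.reg 3 = lg)
    (h8 : s.reg 8 = M) (hc : s.coins = 0) (hm : 1 ≤ m) (hz : ∀ x, n ≤ x → s.data 0 x = 0)
    (hB : n + d + M * d ≤ B) (hB' : d * M * d ≤ B) (ht : n + (2 ^ lg + 1) * d ≤ B)
    (ht' : 2 ^ lg ≤ B) :
    Runs ω B sketchBlocks s (13 * (M * d) * d + 5 * d + 6 +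
      lg * (53 * n * d + 17 * d + 61 * (n + d) * (l + 1) + 34) + 69 * d * d * (l + 1) * M)
      fun s' => ∀ i < n + 1 - m, s'.mag 0 i = s.mag 0 i + ∑ k ∈ Finset.range lg,
        pieceEnergy D H ω (slots d (s.data 0))
          (fun r p a => s.data 1 (r + p * d + a)) M i k := by
  have hd := hP.d_pos
  refine Runs.seq (13 * (M * d) * d + 5 * d + 2) (4 +
      (lg * (53 * n * d + 17 * d + 61 * (n + d) * (l + 1) + 34) + 69 * d * d * (l + 1) * M))
    (runs_copyPattern hs.r7 h8 hP.d_le (by omega)) fun s1 f1 q1 => ?_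
  have g0 : HasParams d D l s1 := hs.of_frame f1
  refine Runs.seq 2 (2 + (lg * (53 * n * d + 17 * d + 61 * (n + d) * (l + 1) + 34) +
      69 * d * d * (l + 1) * M)) (Q := AtLevel ω D H n m M (slots d (s.data 0))
      (fun r p a => s.data 1 (r + p * d + a)) (s.mag 0) 0)
    (.setReg (by have := hP.d_le; simp; omega) ⟨by simp, ?_, ?_, ?_, ?_⟩) fun s2 f2 q2 => ?_
  · simp [f1.coins rfl, hc]
  · simp only [State.tick_data, State.writeReg_data]
    rw [f1.data 0 (by decide)]
    rfl
  · intro r hr b hb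
    rw [pow_zero, Nat.div_one] at hb
    ext a
    simpa [sketch] using q1 r hr b hb a
  · intro i hi
    simp [f1.mag 0 (by decide)]
  · have k0 : HasParams d D l s2 := g0.of_frame f2
    have hk : ∀ r ∉ copyPattern.wreg, r ≠ 9 → s2.reg r = s.reg r := fun r hr h9 =>
      (f2.reg r (by simp [Prog.wreg, h9])).trans (f1.reg r hr)
    have key := Runs.loop_sum (ω := ω) (B := B) (r := 12) (e := reg 3) (c := level) (s := s2)
      (AtLevel ω D H n m M (slots d (s.data 0)) (fun r p a => s.data 1 (r + p * d + a)) (s.mag 0))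
      (fun t => 53 * n * d + 17 * d + 61 * (n + d) * (l + 1) + 33 +
        69 * d * d * (l + 1) * (M / (2 * 2 ^ t))) (N := lg)
      (by rw [WExp.eval_reg, hk 3 (by decide) (by decide), h3])
      (Nat.lt_two_pow_self.le.trans ht') ⟨q2.r9, q2.coins, q2.text, q2.pattern, q2.mag⟩ (by
        intro t htl s' f' I
        have hpow : 2 * 2 ^ t ≤ 2 ^ lg := by
          rw [← pow_succ']; exact Nat.pow_le_pow_right (by norm_num) htl
        have r0 : s'.reg 0 = n := (f'.reg 0 (by decide)).trans
          ((hk 0 (by decide) (by decide)).trans h0)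
        have r1 : s'.reg 1 = m := (f'.reg 1 (by decide)).trans
          ((hk 1 (by decide) (by decide)).trans h1)
        have r8 : s'.reg 8 = M := (f'.reg 8 (by decide)).trans
          ((hk 8 (by decide) (by decide)).trans h8)
        have r9 := I.r9
        have rp : HasParams d D l s' := k0.of_frame f'
        refine runs_level hP ⟨by simp [rp.r5], by simp [rp.r6], by simp [rp.r7]⟩ (by simp [r0])
          (by simp [r1]) (by simp [r8]) hm (fun p hp => ?_) hB hB' ?_ (hpow.trans ht')
          ⟨by simp [r9], I.coins, I.text, I.pattern, I.mag⟩
        · ext a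
          have h2 : n < (n / d + 1) * d := by
            rw [mul_comm]; exact Nat.lt_mul_div_succ n hd
          have h4 : (n / d + 1) * d ≤ p * d := Nat.mul_le_mul_right d hp
          exact hz _ (by omega)
        · refine le_trans ?_ ht
          gcongr
          omega)
    refine key.mono ?_ fun s' _ I => I.mag
    have h5 : ∑ t ∈ Finset.range lg, M / (2 * 2 ^ t) ≤ M :=
      (Nat.le_add_right _ _).trans (sum_div_two_pow_le M lg)
    simp only [Finset.sum_add_distrib, ← Finset.mul_sum, Finset.sum_const, Finset.card_range,
      smul_eq_mul, WExp.size]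
    have h6 := Nat.mul_le_mul_left (69 * d * d * (l + 1)) h5
    nlinarith [h6]

/-- The exponent of the dimension: the least `l` with `κ * ⌈log₂ n⌉ * q ≤ 2 ^ l`. -/
def dimLog (κ n q : ℕ) : ℕ := Nat.clog 2 (κ * (Nat.clog 2 n * q))

lemma eq_clog {V E : ℕ} (h1 : V ≤ 2 ^ E) (h2 : 2 ^ E < 2 * V) : E = Nat.clog 2 V := by
  refine le_antisymm ?_ (Nat.clog_le_of_le_pow h1)
  by_contra hc
  have h3 : 2 ^ (Nat.clog 2 V + 1) ≤ 2 ^ E := Nat.pow_le_pow_right (by norm_num) (by omega)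
  have h4 := Nat.le_pow_clog (b := 2) (by norm_num) V
  rw [pow_succ] at h3
  omega

lemma pow_clog_lt {V : ℕ} (hV : 1 ≤ V) : 2 ^ Nat.clog 2 V < 2 * V := by
  rcases hV.eq_or_lt with rfl | h
  · simp
  · have h1 := Nat.pow_pred_clog_lt_self (b := 2) (by norm_num) h
    have h2 : Nat.clog 2 V = (Nat.clog 2 V).pred + 1 :=
      (Nat.succ_pred_eq_of_pos (Nat.clog_pos (by norm_num) h)).symm
    rw [h2, pow_succ]
    omega

/-- Computes `⌈log₂ n⌉`, the parameters of the sketches and the number of blocks of the windows. -/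
def setup (κ : ℕ) : Prog :=
  .seq (powAbove 0 4 3 10) <| .seq (.setReg 22 (.lit κ * (reg 3 * reg 2))) <|
  .seq (powAbove 22 5 6 10) <| .seq (.setReg 7 (reg 5 * reg 5)) <|
    .setReg 8 (reg 1 / reg 7 - 1)

lemma runs_setup {κ n m q : ℕ} {s : State} (hn : 1 ≤ n) (h0 : s.reg 0 = n) (h1 : s.reg 1 = m)
    (h2 : s.reg 2 = q) (hV : 1 ≤ κ * (Nat.clog 2 n * q)) (hd : d = 2 ^ (2 * dimLog κ n q))
    (hnB : 2 * n ≤ B) (hVB : 2 * (κ * (Nat.clog 2 n * q)) ≤ B) (hdB : d ≤ B) (hmB : m ≤ B) :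
    Runs ω B (setup κ) s (12 * n + 12 * (κ * (Nat.clog 2 n * q)) + 28) fun s' =>
      HasParams d (2 ^ dimLog κ n q) (dimLog κ n q) s' ∧ s'.reg 3 = Nat.clog 2 n ∧
        s'.reg 8 = m / d - 1 := by
  set V := κ * (Nat.clog 2 n * q) with hVdef
  refine Runs.seq (12 * n + 6) (12 * V + 22)
    (runs_powAbove h0 hn hnB (by decide)) (fun s1 f1 ⟨q1, q2, q3⟩ => ?_) (by omega)
  have g3 : s1.reg 3 = Nat.clog 2 n := eq_clog (q1 ▸ q2) (q1 ▸ q3)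
  have g2 : s1.reg 2 = q := (f1.reg 2 (by decide)).trans h2
  have g1 : s1.reg 1 = m := (f1.reg 1 (by decide)).trans h1
  refine Runs.seq 6 (12 * V + 16)
    (Q := fun s' => s'.reg 22 = V ∧ s'.reg 3 = Nat.clog 2 n ∧ s'.reg 1 = m)
    (.setReg (by simp [g3, g2]; change V ≤ _; omega) (by simp [g3, g2, g1, hVdef]))
    (fun s2 f2 ⟨k22, k3, k1⟩ => ?_) (by omega)
  refine Runs.seq (12 * V + 6) 10
    (runs_powAbove k22 hV hVB (by decide)) (fun s3 f3 ⟨q4, q5, q6⟩ => ?_) (by omega)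
  have k6 : s3.reg 6 = dimLog κ n q := eq_clog (q4 ▸ q5) (q4 ▸ q6)
  have k5 : s3.reg 5 = 2 ^ dimLog κ n q := by rw [q4, k6]
  have m3 : s3.reg 3 = Nat.clog 2 n := (f3.reg 3 (by decide)).trans k3
  have m1 : s3.reg 1 = m := (f3.reg 1 (by decide)).trans k1
  have hd2 : d = 2 ^ dimLog κ n q * 2 ^ dimLog κ n q := by rw [hd, two_mul, pow_add]
  refine Runs.seq 4 6 (Q := fun s' => HasParams d (2 ^ dimLog κ n q) (dimLog κ n q) s' ∧
      s'.reg 3 = Nat.clog 2 n ∧ s'.reg 1 = m)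
    (.setReg (by simp [k5, ← hd2]; omega)
      ⟨⟨by simp [k5], by simp [k6], by simp [k5, hd2]⟩, by simp [m3], by simp [m1]⟩)
    fun s4 _ ⟨l0, l3, l1⟩ => ?_
  refine .setReg (by
      have : m / d ≤ m := Nat.div_le_self _ _
      simp [l1, l0.r7]; omega)
    ⟨⟨by simp [l0.r5], by simp [l0.r6], by simp [l0.r7]⟩, by simp [l3], by simp [l1, l0.r7]⟩

/-- The whole program; `κ` governs the failure probability. The registers `0` to `9` hold `n`, `m`,
`⌈1 / ε⌉`, `⌈log₂ n⌉`, a power of two, the normalization `D`, its logarithm `l`, the length `d` of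
the blocks, the number `M` of full blocks of a window, and the current merging distance; the others
are loop counters, addresses and auxiliary values. The data arrays `0` and `1` are the text and the
pattern, the array `2` has room for `M` blocks for each of the `d` alignments of the pattern, and
`3` and `4` are the workspace of the Hadamard transform. -/
def program (κ : ℕ) : Prog :=
  .seq (setup κ) <| .seq addOuter <| .seq (.ifLT 0 (reg 8) sketchBlocks .skip) rootOutput

lemma sub_mul_le_two_mul (hd : 0 < d) (m : ℕ) : m - (m / d - 1) * d ≤ 2 * d := by
  have h1 := Nat.lt_mul_div_succ m hd
  have h2 : d * (m / d + 1) = m / d * d + d := by ring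
  rw [Nat.sub_mul, one_mul]
  omega

/-- The cost of the sketches; they are used only if the windows have full blocks, so that `d` is at
most the length of the text. -/
lemma cost_sketchBlocks_le {n M lg : ℕ} (hd : d = 2 ^ (2 * l)) (hM : 0 < M) (hMd : M * d + d ≤ n)
    (hlg : n ≤ 2 ^ lg) :
    13 * (M * d) * d + 5 * d + 6 + lg * (53 * n * d + 17 * d + 61 * (n + d) * (l + 1) + 34) +
      69 * d * d * (l + 1) * M ≤ 319 * (n * d * lg) := by
  have hd0 : 0 < d := by rw [hd]; positivity
  have hdM : d ≤ M * d := Nat.le_mul_of_pos_left d hM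
  have hll : 2 * l < d := by rw [hd]; exact Nat.lt_two_pow_self
  have hl2 : 2 * l < lg := by
    have : 2 ^ (2 * l) < 2 ^ lg := by rw [← hd]; omega
    exact (Nat.pow_lt_pow_iff_right (by norm_num)).1 this
  have hnd : 2 * d ≤ n * d := Nat.mul_le_mul_right d (by omega)
  have hnn : n ≤ n * d := Nat.le_mul_of_pos_right n hd0
  have hX : n * d ≤ n * d * lg := Nat.le_mul_of_pos_right _ (by omega)
  have a1 : M * d * d ≤ n * d * lg := (Nat.mul_le_mul_right d (by omega)).trans hX
  have a3 : (n + d) * (l + 1) ≤ 2 * (n * d) := by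
    calc (n + d) * (l + 1) ≤ (2 * n) * d := Nat.mul_le_mul (by omega) (by omega)
      _ = _ := by ring
  have a4 : d * d * (l + 1) * M ≤ n * d * lg := by
    calc d * d * (l + 1) * M = (M * d) * d * (l + 1) := by ring
      _ ≤ n * d * lg := Nat.mul_le_mul (Nat.mul_le_mul_right d (by omega)) (by omega)
  have a6 : lg * (53 * n * d + 17 * d + 61 * (n + d) * (l + 1) + 34) ≤
      lg * (226 * (n * d)) := by
    refine Nat.mul_le_mul_left lg ?_
    have : 61 * (n + d) * (l + 1) = 61 * ((n + d) * (l + 1)) := by ring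
    have : 53 * n * d = 53 * (n * d) := by ring
    omega
  have a7 : lg * (226 * (n * d)) = 226 * (n * d * lg) := by ring
  have a8 : 69 * d * d * (l + 1) * M = 69 * (d * d * (l + 1) * M) := by ring
  have a9 : 13 * (M * d) * d = 13 * (M * d * d) := by ring
  omega

/-- What the program computes, within `O(n * d * log n)` steps, for the dimension
`d = 4 ^ dimLog κ n q`. -/
lemma runs_program {κ n m q : ℕ} (hκ : 1 ≤ κ) (hn : 2 ≤ n) (hm : 1 ≤ m) (hmn : m ≤ n) (hq : 1 ≤ q)
    {s : State} (h0 : s.reg 0 = n) (h1 : s.reg 1 = m) (h2 : s.reg 2 = q) (hc : s.coins = 0)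
    (hmag : ∀ i, s.mag 0 i = 0) (hz : ∀ x, n ≤ x → s.data 0 x = 0)
    (hd : d = 2 ^ (2 * dimLog κ n q))
    (fly : ∀ (v : ℕ → ℝ) (a : Fin d),
      (butterfly (d / 2))^[2 * dimLog κ n q] v a = ∑ b, H a b * v b) :
    Runs ω (8 * n * d) (program κ) s (460 * n * d * Nat.clog 2 n) fun s' => ∀ i < n + 1 - m,
      s'.mag 0 i = Real.sqrt
        (∑ j ∈ Finset.range (m - (m / d - 1) * d),
          (s.data 0 (i + outer d (m / d - 1) i j) - s.data 1 (outer d (m / d - 1) i j)) ^ 2 +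
        ∑ k ∈ Finset.range (Nat.clog 2 n),
          pieceEnergy ((2 ^ dimLog κ n q : ℕ) : ℝ) H ω (slots d (s.data 0))
            (fun r p a => s.data 1 (r + p * d + a)) (m / d - 1) i k) := by
  set lg := Nat.clog 2 n with hlg
  set V := κ * (lg * q) with hV
  set l := dimLog κ n q with hl
  set M := m / d - 1 with hM
  have hlg1 : 1 ≤ lg := Nat.clog_pos (by norm_num) hn
  have hlgn : n ≤ 2 ^ lg := Nat.le_pow_clog (by norm_num) n
  have hlgn' : 2 ^ lg < 2 * n := pow_clog_lt (by omega)
  have hV1 : 1 ≤ V := Nat.mul_pos hκ (Nat.mul_pos hlg1 hq)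
  have hVl : V ≤ 2 ^ l := Nat.le_pow_clog (by norm_num) V
  have hVl' : 2 ^ l < 2 * V := pow_clog_lt hV1
  have hd2 : d = 2 ^ l * 2 ^ l := by rw [hd, two_mul, pow_add]
  have hld : 2 ^ l ≤ d := by rw [hd2]; exact Nat.le_mul_of_pos_left _ (by positivity)
  have hd0 : 0 < d := by rw [hd]; positivity
  have hll : 2 * l ≤ d := by rw [hd]; exact Nat.lt_two_pow_self.le
  have hlgV : lg ≤ V := (Nat.le_mul_of_pos_right lg hq).trans (Nat.le_mul_of_pos_left _ hκ)
  have hnd : 1 ≤ n * d := Nat.mul_pos (by omega) hd0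
  have hndn : n ≤ n * d := Nat.le_mul_of_pos_right _ hd0
  have hndd : 2 * d ≤ n * d := Nat.mul_le_mul_right d hn
  have hB8 : 8 * n * d = 8 * (n * d) := by ring
  have hdiv : m / d * d ≤ m := Nat.div_mul_le_self m d
  have hMd : M * d ≤ m := (Nat.mul_le_mul_right d (Nat.sub_le _ _)).trans hdiv
  have hP : Params (8 * n * d) d (2 ^ l) l H :=
    ⟨hd, rfl, by omega, by omega, fly⟩
  have hout : m - M * d ≤ 2 * d := sub_mul_le_two_mul hd0 m
  have hMdn : 0 < M → M * d + d ≤ n := by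
    intro h
    have h1 : M + 1 = m / d := by omega
    have h2 : M * d + d = m / d * d := by rw [← h1]; ring
    omega
  have hX : n * d ≤ n * d * lg := Nat.le_mul_of_pos_right _ hlg1
  have hno : n * (19 + 23 * (m - M * d)) + 6 ≤ 19 * n + 46 * (n * d) + 6 := by
    have := Nat.mul_le_mul_left n (Nat.mul_le_mul_left 23 hout)
    nlinarith
  have htot : 460 * n * d * lg = 460 * (n * d * lg) := by ring
  have hVd : V ≤ d := hVl.trans hld
  refine Runs.seq (12 * n + 12 * V + 28) (420 * (n * d * lg) - 28)
    (runs_setup (by omega) h0 h1 h2 hV1 hd (by omega)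
      (show 2 * V ≤ 8 * n * d by omega) hP.d_le (by omega))
    (fun s5 f5 ⟨rp, r3, k8⟩ => ?_) (by omega)
  have r0 : s5.reg 0 = n := (f5.reg 0 (by simp [setup, powAbove, Prog.wreg])).trans h0
  have r1 : s5.reg 1 = m := (f5.reg 1 (by simp [setup, powAbove, Prog.wreg])).trans h1
  have rd : ∀ x, s5.data x = s.data x := fun x =>
    f5.data x (by simp [setup, powAbove, Prog.wdata])
  have rm : s5.mag 0 = s.mag 0 := f5.mag 0 (by simp [setup, powAbove, Prog.wmag])
  have rc : s5.coins = 0 := (f5.coins (by simp [setup, powAbove, Prog.flips])).trans hc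
  have hBM : n + d + M * d ≤ 8 * n * d := by omega
  refine Runs.seq (n * (19 + 23 * (m - M * d)) + 6) (3 + 319 * (n * d * lg) + (6 * n + 6))
    (runs_addOuter hd0 r0 r1 rp.r7 k8 hm hmn hBM) (fun s6 f6 q7 => ?_) (by omega)
  have t0 : s6.reg 0 = n := (f6.reg 0 (by decide)).trans r0
  have t1 : s6.reg 1 = m := (f6.reg 1 (by decide)).trans r1
  have t8 : s6.reg 8 = M := (f6.reg 8 (by decide)).trans k8
  have td0 : s6.data 0 = s.data 0 := (f6.data 0 (by decide)).trans (rd 0)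
  have td1 : s6.data 1 = s.data 1 := (f6.data 1 (by decide)).trans (rd 1)
  have tp : HasParams d (2 ^ l) l s6 := rp.of_frame f6
  rw [rm, rd 0, rd 1] at q7
  refine Runs.seq (3 + 319 * (n * d * lg)) (6 * n + 6) (Q := fun s' => ∀ i < n + 1 - m,
      s'.mag 0 i = s6.mag 0 i + ∑ k ∈ Finset.range lg,
        pieceEnergy ((2 ^ l : ℕ) : ℝ) H ω (slots d (s.data 0))
          (fun r p a => s.data 1 (r + p * d + a)) M i k) ?_ (fun s7 f7 q8 => ?_)
  · refine Runs.ifLT (319 * (n * d * lg)) (fun hlt => ?_) (fun hlt => ?_)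
      (by change 3 + _ ≤ _; omega)
    · simp [t8] at hlt
      have a1 : d * M * d ≤ n * d := Nat.mul_le_mul_right d (by rw [mul_comm]; omega)
      have a2 : (2 ^ lg + 1) * d ≤ 2 * n * d := Nat.mul_le_mul_right d (by omega)
      have a3 : 2 * n * d = 2 * (n * d) := by ring
      have := runs_sketchBlocks (ω := ω) (s := s6.tick ((0 : WExp).size + (reg 8).size + 1))
        (lg := lg) hP ⟨tp.r5, tp.r6, tp.r7⟩ t0 t1 ((f6.reg 3 (by decide)).trans r3) t8
        ((f6.coins rfl).trans rc) hm (fun x hx => by rw [State.tick_data, td0, hz x hx]) hBM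
        (by omega) (by omega) (by omega)
      refine this.mono (cost_sketchBlocks_le hd hlt (hMdn hlt) hlgn) fun s' _ q i hi => ?_
      rw [q i hi]
      simp only [State.tick_data, State.tick_mag, td0, td1]
    · simp [t8] at hlt
      refine Runs.skip (fun i hi => ?_) (by omega)
      simp [hlt, pieceEnergy]
  · refine (runs_rootOutput ((f7.reg 0 (by decide)).trans t0) ((f7.reg 1 (by decide)).trans t1) hm
      (by omega)).mono le_rfl fun s' _ q i hi => ?_
    rw [q i hi, q8 i hi, q7 i hi, hmag, zero_add]

/-! ### Correctness of the output -/

lemma sum_range_mul_eq (F : ℕ → ℝ) (M d : ℕ) :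
    ∑ x ∈ Finset.range (M * d), F x = ∑ p ∈ Finset.range M, ∑ a : Fin d, F (p * d + a) := by
  induction M with
  | zero => simp
  | succ M ih =>
    rw [Nat.succ_mul, Finset.sum_range_add, ih, Finset.sum_range_succ,
      Finset.sum_range fun x => F (M * d + x)]

/-- A window consists of its outer letters and of its `M` full blocks. -/
lemma sum_window_eq {M i m : ℕ} (hM : gap d i + M * d ≤ m) (F : ℕ → ℝ) :
    ∑ j ∈ Finset.range m, F j = ∑ j ∈ Finset.range (m - M * d), F (outer d M i j) +
      ∑ p ∈ Finset.range M, ∑ a : Fin d, F (gap d i + p * d + a) := by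
  obtain ⟨x, rfl⟩ := Nat.exists_eq_add_of_le hM
  have h := sum_range_mul_eq (fun x => F (gap d i + x)) M d
  simp only [← add_assoc] at h
  rw [← h, show gap d i + M * d + x - M * d = gap d i + x by omega, Finset.sum_range_add,
    Finset.sum_range_add, Finset.sum_range_add]
  have h1 : ∑ j ∈ Finset.range (gap d i), F (outer d M i j) = ∑ j ∈ Finset.range (gap d i), F j :=
    Finset.sum_congr rfl fun j hj => by rw [outer, if_pos (Finset.mem_range.1 hj)]
  have h2 : ∀ j, outer d M i (gap d i + j) = gap d i + M * d + j := fun j => by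
    rw [outer, if_neg (by omega)]; omega
  simp only [h1, h2]
  ring

/-- The blocks of a window are split into pieces according to the binary digits of their number. -/
lemma sum_range_eq_sum_pieces (φ : ℕ → ℝ) (M : ℕ) : ∀ K,
    ∑ p ∈ Finset.range M, φ p = ∑ p ∈ Finset.range (M / 2 ^ K * 2 ^ K), φ p +
      ∑ k ∈ Finset.range K, if M / 2 ^ k % 2 = 1 then
        ∑ p ∈ Finset.range (2 ^ k), φ (pieceStart M (2 ^ k) + p) else 0
  | 0 => by simp
  | K + 1 => by
    rw [sum_range_eq_sum_pieces φ M K, Finset.sum_range_succ _ K, ← add_assoc,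
      add_right_comm]
    congr 1
    have h1 : M / 2 ^ (K + 1) = M / 2 ^ K / 2 := by rw [pow_succ, Nat.div_div_eq_div_mul]
    have h2 : M / 2 ^ (K + 1) * 2 ^ (K + 1) = M / 2 ^ K / 2 * 2 * 2 ^ K := by
      rw [h1, pow_succ]; ring
    rw [h2]
    by_cases h : M / 2 ^ K % 2 = 1
    · have h3 : M / 2 ^ K = M / 2 ^ K / 2 * 2 + 1 := by omega
      have h4 : M / 2 ^ K - 1 = M / 2 ^ K / 2 * 2 := by omega
      have h5 : M / 2 ^ K * 2 ^ K = M / 2 ^ K / 2 * 2 * 2 ^ K + 2 ^ K := by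
        conv_lhs => rw [h3]
        rw [Nat.add_mul, one_mul]
      rw [if_pos h, pieceStart, h4, ← Finset.sum_range_add, h5]
    · rw [if_neg h, add_zero, show M / 2 ^ K / 2 * 2 = M / 2 ^ K by omega]

/-- The differences of the blocks of the window `i` and the aligned blocks of the pattern. -/
def blockDiff (fT : ℕ → Fin d → ℝ) (fP : ℕ → ℕ → Fin d → ℝ) (i p : ℕ) : Fin d → ℝ :=
  fT (blk d i + p) - fP (gap d i) p

/-- The sketch of the first `2 ^ k` vectors of `g` has their energy, up to a factor `1 ± ε`. -/
def Preserves (D : ℝ) (H : Fin d → Fin d → ℝ) (ε : ℝ) (k : ℕ) (g : ℕ → Fin d → ℝ)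
    (ω : ℕ → Bool) : Prop :=
  (1 - ε) * ∑ p ∈ Finset.range (2 ^ k), nsq (g p) ≤ nsq (sketch D H ω k g 0) ∧
    nsq (sketch D H ω k g 0) ≤ (1 + ε) * ∑ p ∈ Finset.range (2 ^ k), nsq (g p)

lemma sketch_blockDiff (D : ℝ) (fT : ℕ → Fin d → ℝ) (fP : ℕ → ℕ → Fin d → ℝ) (i k o : ℕ) :
    sketch D H ω k (fun p => blockDiff fT fP i (o + p)) 0 =
      sketch D H ω k fT (blk d i + o) - sketch D H ω k (fP (gap d i)) o := by
  have h : (fun p => blockDiff fT fP i (o + p)) =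
      (fun p => fT (blk d i + o + p)) - fun p => fP (gap d i) (o + p) := by
    funext p
    simp only [blockDiff, Pi.sub_apply, add_assoc]
  rw [h, sketch_sub, sketch_shift, sketch_shift]
  simp

lemma sum_pieceEnergy_bounds {D ε : ℝ} {fT : ℕ → Fin d → ℝ} {fP : ℕ → ℕ → Fin d → ℝ} {M i K : ℕ}
    (hM : M < 2 ^ K)
    (h : ∀ k < K, Preserves D H ε k (fun p => blockDiff fT fP i (pieceStart M (2 ^ k) + p)) ω) :
    (1 - ε) * ∑ p ∈ Finset.range M, nsq (blockDiff fT fP i p) ≤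
        ∑ k ∈ Finset.range K, pieceEnergy D H ω fT fP M i k ∧
      ∑ k ∈ Finset.range K, pieceEnergy D H ω fT fP M i k ≤
        (1 + ε) * ∑ p ∈ Finset.range M, nsq (blockDiff fT fP i p) := by
  rw [sum_range_eq_sum_pieces _ M K, Nat.div_eq_of_lt hM, zero_mul, Finset.sum_range_zero, zero_add,
    Finset.mul_sum, Finset.mul_sum]
  constructor <;> refine Finset.sum_le_sum fun k hk => ?_ <;>
  · have hk := h k (Finset.mem_range.1 hk)
    rw [Preserves, sketch_blockDiff] at hk
    rw [pieceEnergy]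
    split_ifs
    · first | exact hk.1 | exact hk.2
    · rw [mul_zero]

lemma sqrt_bounds {ε x y : ℝ} (h0 : 0 < ε) (h1 : ε < 1) (hx : 0 ≤ x) (hl : (1 - ε) * x ≤ y)
    (hu : y ≤ (1 + ε) * x) :
    (1 - ε) * Real.sqrt x ≤ Real.sqrt y ∧ Real.sqrt y ≤ (1 + ε) * Real.sqrt x := by
  have e1 : ∀ a : ℝ, 0 ≤ a → a * Real.sqrt x = Real.sqrt (a ^ 2 * x) := fun a ha => by
    rw [Real.sqrt_mul (sq_nonneg a), Real.sqrt_sq ha]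
  rw [e1 _ (by linarith), e1 _ (by linarith)]
  have h2 : 0 ≤ ε * x := mul_nonneg h0.le hx
  constructor <;> apply Real.sqrt_le_sqrt <;> nlinarith

lemma sum_sq_window_eq (hd : 0 < d) (T P : ℕ → ℝ) (i m : ℕ) :
    ∑ j ∈ Finset.range m, (T (i + j) - P j) ^ 2 =
      ∑ j ∈ Finset.range (m - (m / d - 1) * d),
        (T (i + outer d (m / d - 1) i j) - P (outer d (m / d - 1) i j)) ^ 2 +
      ∑ p ∈ Finset.range (m / d - 1),
        nsq (blockDiff (slots d T) (fun r p (a : Fin d) => P (r + p * d + a)) i p) := by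
  have hblock : ∀ p, nsq (blockDiff (slots d T) (fun r p (a : Fin d) => P (r + p * d + a)) i p) =
      ∑ a : Fin d, (T (i + (gap d i + p * d + a)) - P (gap d i + p * d + a)) ^ 2 := fun p => by
    refine Finset.sum_congr rfl fun a _ => ?_
    have h1 := (blk_mul_le hd i).1
    have h2 : (blk d i + p) * d + a = i + (gap d i + p * d + a) := by
      rw [gap, Nat.add_mul]; omega
    simp only [blockDiff, slots, Pi.sub_apply, h2]
  simp only [hblock]
  rcases Nat.eq_zero_or_pos (m / d - 1) with h0 | h0
  · simp [h0, outer]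
  · refine sum_window_eq ?_ fun j => (T (i + j) - P j) ^ 2
    have h1 := gap_lt hd i
    have h2 := Nat.div_mul_le_self m d
    have h3 : (m / d - 1) * d + d = m / d * d := by
      rw [← Nat.succ_mul, Nat.succ_eq_add_one, show m / d - 1 + 1 = m / d by omega]
    omega

/-! ### The resources used and the probability of failure -/

lemma two_pow_dimLog_le {κ n q : ℕ} (hV : 1 ≤ κ * (Nat.clog 2 n * q)) :
    2 ^ dimLog κ n q ≤ 2 * (κ * (Nat.clog 2 n * q)) := (pow_clog_lt hV).le

lemma two_pow_clog_le {n : ℕ} (hn : 2 ≤ n) : 2 ^ Nat.clog 2 n ≤ 2 * n :=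
  (pow_clog_lt (by omega)).le

lemma clog_le_self (n : ℕ) : Nat.clog 2 n ≤ n := Nat.clog_le_of_le_pow Nat.lt_two_pow_self.le

lemma clog_le_log {n : ℕ} (hn : 2 ≤ n) : (Nat.clog 2 n : ℝ) ≤ 3 * Real.log n := by
  have hn' : (2 : ℝ) ≤ n := by exact_mod_cast hn
  have h1 : ((2 : ℝ) ^ Nat.clog 2 n) ≤ 2 * n := by exact_mod_cast two_pow_clog_le hn
  have h2 := Real.log_le_log (by positivity) h1
  rw [Real.log_pow, Real.log_mul (by norm_num) (by positivity)] at h2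
  have h3 := Real.log_two_gt_d9
  have h4 := Real.log_le_log (by norm_num) hn'
  have h5 : (Nat.clog 2 n : ℝ) * 0.69 ≤ Nat.clog 2 n * Real.log 2 := by gcongr; linarith
  linarith

lemma ceil_one_div_le {ε : ℝ} (h0 : 0 < ε) (h1 : ε < 1) : ((⌈1 / ε⌉₊ : ℕ) : ℝ) ≤ 2 / ε := by
  have h2 := (Nat.ceil_lt_add_one (one_div_pos.2 h0).le).le
  have h3 : 1 ≤ 1 / ε := (one_le_div h0).2 h1.le
  have h4 : 2 / ε = 1 / ε + 1 / ε := by ring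
  linarith

lemma time_bound {κ n d : ℕ} {ε : ℝ} (hn : 2 ≤ n) (h0 : 0 < ε) (h1 : ε < 1)
    (hd : d ≤ (2 * (κ * (Nat.clog 2 n * ⌈1 / ε⌉₊))) ^ 2) :
    ((460 * n * d * Nat.clog 2 n : ℕ) : ℝ) ≤
      (198720 * κ ^ 2 : ℕ) * (n * Real.log n ^ 3 / ε ^ 2) := by
  have hd' : (d : ℝ) ≤ (2 * (κ * (Nat.clog 2 n * (⌈1 / ε⌉₊ : ℕ)))) ^ 2 := by exact_mod_cast hd
  have hq := ceil_one_div_le h0 h1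
  have hlg := clog_le_log hn
  push_cast
  calc (460 : ℝ) * n * d * Nat.clog 2 n
      ≤ 460 * n * (2 * (κ * (Nat.clog 2 n * (⌈1 / ε⌉₊ : ℕ)))) ^ 2 * Nat.clog 2 n := by gcongr
    _ = 1840 * κ ^ 2 * n * (Nat.clog 2 n) ^ 3 * (⌈1 / ε⌉₊ : ℕ) ^ 2 := by ring
    _ ≤ 1840 * κ ^ 2 * n * (3 * Real.log n) ^ 3 * (2 / ε) ^ 2 := by gcongr
    _ = 198720 * κ ^ 2 * (n * Real.log n ^ 3 / ε ^ 2) := by ring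

lemma peak_bound {κ n d : ℕ} {ε : ℝ} (hn : 2 ≤ n) (h0 : 0 < ε) (h1 : ε < 1)
    (hd : d ≤ (2 * (κ * (Nat.clog 2 n * ⌈1 / ε⌉₊))) ^ 2) :
    ((8 * n * d : ℕ) : ℝ) ≤ (n / ε) ^ (128 * κ ^ 2 + 3) := by
  have hd' : (d : ℝ) ≤ (2 * (κ * (Nat.clog 2 n * (⌈1 / ε⌉₊ : ℕ)))) ^ 2 := by exact_mod_cast hd
  have hq := ceil_one_div_le h0 h1
  have hlg : (Nat.clog 2 n : ℝ) ≤ n := by exact_mod_cast clog_le_self n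
  have hn' : (2 : ℝ) ≤ n := by exact_mod_cast hn
  have hnε : 2 ≤ n / ε := (le_div_iff₀ h0).2 (by nlinarith)
  have hpow : ((128 * κ ^ 2 : ℕ) : ℝ) ≤ 2 ^ (128 * κ ^ 2) := by
    exact_mod_cast Nat.lt_two_pow_self.le
  have hε : 1 / ε ^ 2 ≤ 1 / ε ^ 3 :=
    one_div_le_one_div_of_le (by positivity) (pow_le_pow_of_le_one h0.le h1.le (by norm_num))
  push_cast at hpow ⊢
  calc (8 : ℝ) * n * d
      ≤ 8 * n * (2 * (κ * (n * (2 / ε)))) ^ 2 := by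
        refine mul_le_mul_of_nonneg_left (hd'.trans ?_) (by positivity)
        gcongr
    _ = 128 * κ ^ 2 * (n ^ 3 * (1 / ε ^ 2)) := by ring
    _ ≤ 128 * κ ^ 2 * (n ^ 3 * (1 / ε ^ 3)) := by gcongr
    _ = 128 * κ ^ 2 * (n / ε) ^ 3 := by rw [div_pow, mul_one_div]
    _ ≤ 2 ^ (128 * κ ^ 2) * (n / ε) ^ 3 := by gcongr
    _ ≤ (n / ε) ^ (128 * κ ^ 2) * (n / ε) ^ 3 := by gcongr
    _ = _ := by rw [← pow_add]

lemma failure_bound {c n : ℕ} {x : ℝ} (hn : 2 ≤ n) (hx : (c + 6 : ℕ) * (Nat.clog 2 n : ℝ) ≤ x) :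
    n * (Nat.clog 2 n * (4 ^ Nat.clog 2 n * Real.exp (-x))) ≤ 1 / (n : ℝ) ^ c := by
  have hn' : (2 : ℝ) ≤ n := by exact_mod_cast hn
  have hlg : (Nat.clog 2 n : ℝ) ≤ n := by exact_mod_cast clog_le_self n
  have h4 : (4 : ℝ) ^ Nat.clog 2 n ≤ n ^ 4 := by
    have h1 : (2 : ℝ) ^ Nat.clog 2 n ≤ 2 * n := by exact_mod_cast two_pow_clog_le hn
    calc (4 : ℝ) ^ Nat.clog 2 n = (2 ^ Nat.clog 2 n) ^ 2 := by
          rw [← pow_mul, mul_comm, pow_mul]; norm_num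
      _ ≤ (2 * n) ^ 2 := by gcongr
      _ = 2 ^ 2 * n ^ 2 := by ring
      _ ≤ n ^ 2 * n ^ 2 := by gcongr
      _ = _ := by ring
  have he : (n : ℝ) ^ (c + 6) ≤ Real.exp x := by
    have h1 : (n : ℝ) ≤ 2 ^ Nat.clog 2 n := by
      exact_mod_cast Nat.le_pow_clog (by norm_num) n
    have h2 : (2 : ℝ) ≤ Real.exp 1 := by have := Real.add_one_le_exp (1 : ℝ); linarith
    calc (n : ℝ) ^ (c + 6) ≤ (Real.exp 1 ^ Nat.clog 2 n) ^ (c + 6) := by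
          refine pow_le_pow_left₀ (by positivity) (h1.trans ?_) _
          gcongr
      _ = Real.exp ((c + 6 : ℕ) * (Nat.clog 2 n : ℝ)) := by
          rw [← Real.exp_nat_mul, ← Real.exp_nat_mul, mul_one]
      _ ≤ Real.exp x := Real.exp_le_exp.2 hx
  rw [Real.exp_neg, le_div_iff₀ (by positivity)]
  calc n * (Nat.clog 2 n * (4 ^ Nat.clog 2 n * (Real.exp x)⁻¹)) * (n : ℝ) ^ c
      ≤ n * (n * (n ^ 4 * (Real.exp x)⁻¹)) * (n : ℝ) ^ c := by gcongr
    _ = n ^ (c + 6) * (Real.exp x)⁻¹ := by ring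
    _ ≤ Real.exp x * (Real.exp x)⁻¹ := by gcongr
    _ = 1 := mul_inv_cancel₀ (Real.exp_pos x).ne'

/-- A union bound over the windows and the binary digits. -/
lemma coinMeasure_not_preserves_le (hH : IsHadamard H) {D : ℝ} (hD : 0 < D) (hd : D ^ 2 = d)
    {ε : ℝ} (h0 : 0 ≤ ε) (h1 : ε ≤ 1) (N K : ℕ) (g : ℕ → ℕ → ℕ → Fin d → ℝ) :
    coinMeasure {ω | ¬ ∀ i < N, ∀ k < K, Preserves D H ε k (g i k) ω} ≤
      ENNReal.ofReal (N * (K * (4 ^ K * Real.exp (-(D * ε / 4))))) := by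
  have hsub : {ω | ¬ ∀ i < N, ∀ k < K, Preserves D H ε k (g i k) ω} ⊆
      ⋃ i ∈ Finset.range N, ⋃ k ∈ Finset.range K, {ω | ¬ Preserves D H ε k (g i k) ω} := by
    intro ω hω
    simp only [Set.mem_ofPred_eq] at hω
    push Not at hω
    simpa using hω
  refine (measure_mono hsub).trans ((measure_biUnion_finset_le _ _).trans ?_)
  have hk : ∀ i, coinMeasure (⋃ k ∈ Finset.range K, {ω | ¬ Preserves D H ε k (g i k) ω}) ≤
      ENNReal.ofReal (K * (4 ^ K * Real.exp (-(D * ε / 4)))) := fun i => by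
    refine (measure_biUnion_finset_le _ _).trans ?_
    calc _ ≤ ∑ k ∈ Finset.range K, ENNReal.ofReal (4 ^ K * Real.exp (-(D * ε / 4))) := by
          refine Finset.sum_le_sum fun k hk => ?_
          refine (coinMeasure_nsq_sketch hH hD hd (g i k) k h0 h1).trans ?_
          refine ENNReal.ofReal_le_ofReal ?_
          gcongr
          · norm_num
          · exact (Finset.mem_range.1 hk).le
      _ = _ := by
          rw [Finset.sum_const, Finset.card_range, nsmul_eq_mul,
            ENNReal.ofReal_mul (Nat.cast_nonneg K), ENNReal.ofReal_natCast]
  calc _ ≤ ∑ i ∈ Finset.range N, ENNReal.ofReal (K * (4 ^ K * Real.exp (-(D * ε / 4)))) :=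
        Finset.sum_le_sum fun i _ => hk i
    _ = _ := by
        rw [Finset.sum_const, Finset.card_range, nsmul_eq_mul,
          ENNReal.ofReal_mul (Nat.cast_nonneg N), ENNReal.ofReal_natCast]

lemma dist₂_eq {n m : ℕ} (T : Fin n → ℝ) (P : Fin m → ℝ) (q i : ℕ) (hi : i + m ≤ n) :
    TextPattern.dist₂ T P i hi = Real.sqrt (∑ j ∈ Finset.range m,
      ((TextPattern.input q T P).data 0 (i + j) - (TextPattern.input q T P).data 1 j) ^ 2) := by
  rw [TextPattern.dist₂, Finset.sum_range]
  congr 1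
  refine Finset.sum_congr rfl fun j _ => ?_
  have h1 := j.2
  rw [sq_abs]
  simp [TextPattern.input, show i + (j : ℕ) < n by omega]

end Sketch

open Sketch in
theorem theorem1 :
    ∀ c : ℕ, ∃ (A : RAM.Prog) (C b : ℕ),
      ∀ (n m : ℕ) (ε : ℝ), 2 ≤ n → 1 ≤ m → m ≤ n → 0 < ε → ε < 1 →
        ∀ (T : Fin n → ℝ) (P : Fin m → ℝ),
          (∀ ω : ℕ → Bool,
            ((TextPattern.final A ε T P ω).time : ℝ) ≤ C * (n * Real.log n ^ 3 / ε ^ 2) ∧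
            ((TextPattern.final A ε T P ω).peak : ℝ) ≤ (n / ε) ^ b) ∧
          RAM.coinMeasure
              {ω | ¬ TextPattern.IsApprox ε T P ((TextPattern.final A ε T P ω).mag 0)}
            ≤ ENNReal.ofReal (1 / (n : ℝ) ^ c) := by
  intro c
  -- the exponential tail `exp (-D * ε / 4)` has to beat `n ^ (c + 6)`
  set κ := 4 * (c + 6) with hκ
  refine ⟨program κ, 198720 * κ ^ 2, 128 * κ ^ 2 + 3, fun n m ε hn hm hmn h0 h1 T P => ?_⟩
  set q := ⌈1 / ε⌉₊ with hq
  set s := TextPattern.input q T P with hs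
  have hq1 : 1 ≤ q := Nat.ceil_pos.2 (one_div_pos.2 h0)
  have hqε : 1 ≤ q * ε := by
    have := Nat.le_ceil (1 / ε)
    rwa [div_le_iff₀ h0] at this
  have hlg1 : 1 ≤ Nat.clog 2 n := Nat.clog_pos (by norm_num) hn
  have hV : 1 ≤ κ * (Nat.clog 2 n * q) := Nat.mul_pos (by omega) (Nat.mul_pos hlg1 hq1)
  set l := dimLog κ n q with hl
  obtain ⟨d, hd⟩ : ∃ d, d = 2 ^ (2 * l) := ⟨_, rfl⟩
  have hd0 : 0 < d := by rw [hd]; positivity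
  have hd2 : d = (2 ^ l) ^ 2 := by rw [hd, mul_comm, pow_mul]
  have hdle : d ≤ (2 * (κ * (Nat.clog 2 n * q))) ^ 2 := by
    rw [hd2]
    exact Nat.pow_le_pow_left (two_pow_dimLog_le hV) 2
  obtain ⟨H, hH, fly⟩ := exists_hadamard (2 * l) d hd
  have run := fun ω => runs_program (ω := ω) (H := H) (κ := κ) (s := s) (by omega) hn hm hmn hq1 rfl
    rfl rfl rfl (fun _ => rfl) (fun x hx => by simp [hs, TextPattern.input, hx]) hd fly
  refine ⟨fun ω => ⟨?_, ?_⟩, ?_⟩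
  · refine le_trans ?_ (time_bound hn h0 h1 hdle)
    exact_mod_cast (run ω).time.trans_eq (zero_add _)
  · refine le_trans ?_ (peak_bound hn h0 h1 hdle)
    exact_mod_cast (run ω).peak.trans_eq (Nat.zero_max _)
  · set g : ℕ → ℕ → ℕ → Fin d → ℝ := fun i k p => blockDiff (slots d (s.data 0))
      (fun r p (a : Fin d) => s.data 1 (r + p * d + a)) i (pieceStart (m / d - 1) (2 ^ k) + p)
      with hg
    have hsub : {ω | ¬ TextPattern.IsApprox ε T P ((TextPattern.final (program κ) ε T P ω).mag 0)} ⊆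
        {ω | ¬ ∀ i < n, ∀ k < Nat.clog 2 n, Preserves ((2 ^ l : ℕ) : ℝ) H ε k (g i k) ω} := by
      refine fun ω hω hgood => hω fun i hi => ?_
      have hM : m / d - 1 < 2 ^ Nat.clog 2 n := by
        have := Nat.div_le_self m d
        have := Nat.le_pow_clog (b := 2) (by norm_num) n
        omega
      obtain ⟨b1, b2⟩ := sum_pieceEnergy_bounds hM (hgood i (by omega))
      have hout : 0 ≤ ∑ j ∈ Finset.range (m - (m / d - 1) * d),
          (s.data 0 (i + outer d (m / d - 1) i j) - s.data 1 (outer d (m / d - 1) i j)) ^ 2 :=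
        Finset.sum_nonneg fun _ _ => sq_nonneg _
      have hfin := (run ω).post i (by omega)
      have hdist := dist₂_eq T P q i hi
      rw [← hs, sum_sq_window_eq hd0] at hdist
      rw [TextPattern.final, ← hq, ← hs, hfin, hdist]
      refine sqrt_bounds h0 h1 (add_nonneg hout (Finset.sum_nonneg fun _ _ => nsq_nonneg _)) ?_ ?_
      · nlinarith
      · nlinarith
    refine (measure_mono hsub).trans ?_
    refine (coinMeasure_not_preserves_le hH (by positivity) (by exact_mod_cast hd2.symm) h0.le h1.le
      n _ g).trans (ENNReal.ofReal_le_ofReal (failure_bound hn ?_))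
    have hVl : κ * (Nat.clog 2 n * q) ≤ 2 ^ l := Nat.le_pow_clog (by norm_num) _
    have hVl' : (κ * (Nat.clog 2 n * q) : ℝ) ≤ (2 ^ l : ℕ) := by exact_mod_cast hVl
    have hκ' : (κ : ℝ) = 4 * (c + 6 : ℕ) := by rw [hκ]; push_cast; ring
    have hlg0 : (0 : ℝ) ≤ (c + 6 : ℕ) * Nat.clog 2 n := by positivity
    rw [le_div_iff₀ (by norm_num)]
    calc (c + 6 : ℕ) * (Nat.clog 2 n : ℝ) * 4 = κ * Nat.clog 2 n * 1 := by rw [hκ']; ring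
      _ ≤ κ * Nat.clog 2 n * (q * ε) := by gcongr
      _ = κ * (Nat.clog 2 n * q) * ε := by ring
      _ ≤ (2 ^ l : ℕ) * ε := by gcongr
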